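/- Let $d\ge 1$ and let $\mathcal F(\mathbb C^d)$ be the Fock space of entire functions $f$ on $\mathbb C^d$ with $\|f\|^2=(2\pi)^{-d}\int_{\mathbb C^d}|f(z)|^2e^{-|z|^2/2}\,dA(z)<\infty$, where $dA$ is Lebesgue measure, a Hilbert space with the corresponding inner product. Let $A\in\mathbb C^{d\times d}$, $A\neq0$, and $b\in\mathbb C^d$ be such that the composition operator $C_\varphi f=f\circ\varphi$ with symbol $\varphi(z)=Az+b$ is a bounded compact operator on $\mathcal F(\mathbb C^d)$. For $n\ge1$ let $$a_n(C_\varphi)=\inf\{\|C_\varphi-S\| : S \text{ a bounded operator on } \mathcal F(\mathbb C^d),\ \dim S(\mathcal F(\mathbb C^d))\le n-1\}$$ be its $n$-th approximation number. Let $\lambda_1,\dots,\lambda_d\ge 0$ be the singular values of $A$ (with multiplicity, in any order), and put $\lambda^\alpha=\prod_{j=1}^d\lambda_j^{\alpha_j}$ for $\alpha\in\mathbb N^d$, where $\mathbb N=\{0,1,2,\dots\}$ and $0^0=1$. Let $B=\sqrt{AA^*}$ be the positive semidefinite square root, let $v=(I+B)^{-1}b$, and let $\langle z,w\rangle=\sum_{j=1}^d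 z_j\overline{w_j}$, $|z|=\sqrt{\langle z,z\rangle}$. If $(\alpha_n)_{n\ge1}$ is an enumeration without repetition of $\{\alpha\in\mathbb N^d:\lambda^\alpha\ne0\}$ such that $(\lambda^{\alpha_n})_{n\ge1}$ is nonincreasing, then for every $n\ge1$ $$a_n(C_\varphi)=\exp\left(\frac{\langle (I-B)^{-1}v,v\rangle}{2}-\frac{|v|^2}{4}\right)\lambda^{\alpha_n}.$$ In particular, $$\sum_{n=1}^\infty a_n(C_\varphi)=\exp\left(\frac{\langle (I-B)^{-1}v,v\rangle}{2}-\frac{|v|^2}{4}\right)\prod_{j=1}^d\frac1{1-\lambda_j}.$$ -/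

import Mathlib

open MeasureTheory

/-- `d`-dimensional complex Euclidean space `ℂ^d`. -/
abbrev CSpace (d : ℕ) : Type := EuclideanSpace ℂ (Fin d)

/-- Entire functions on `ℂ^d` that are square integrable against `e^{-|z|²/2} dA(z)`. -/
def fockSet (d : ℕ) : Set (CSpace d → ℂ) :=
  {f | Differentiable ℂ f ∧ Integrable (fun z => ‖f z‖ ^ 2 * Real.exp (-‖z‖ ^ 2 / 2)) volume}

theorem fock_integrable_mul {d : ℕ} {f g : CSpace d → ℂ} (hf : f ∈ fockSet d)
    (hg : g ∈ fockSet d) :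
    Integrable (fun z => (starRingEnd ℂ) (f z) * g z * (Real.exp (-‖z‖ ^ 2 / 2) : ℂ)) volume := by
  refine (hf.2.add hg.2).mono' ?_ ?_
  · have h1 := hf.1.continuous
    have h2 := hg.1.continuous
    exact Continuous.aestronglyMeasurable (by fun_prop)
  · refine Filter.Eventually.of_forall fun z => ?_
    have he := Real.exp_pos (-‖z‖ ^ 2 / 2)
    simp only [norm_mul, RCLike.norm_conj, Complex.norm_real, Real.norm_eq_abs, abs_of_pos he,
      Pi.add_apply]
    have : ‖f z‖ * ‖g z‖ ≤ ‖f z‖ ^ 2 + ‖g z‖ ^ 2 := by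
      nlinarith [sq_nonneg (‖f z‖ - ‖g z‖), sq_nonneg ‖f z‖, sq_nonneg ‖g z‖]
    nlinarith

/-- The Fock space as a linear subspace of the space of all functions on `ℂ^d`. -/
def fockSubmodule (d : ℕ) : Submodule ℂ (CSpace d → ℂ) where
  carrier := fockSet d
  zero_mem' := ⟨differentiable_const (0 : ℂ), by simp⟩
  add_mem' := by
    intro f g hf hg
    refine ⟨hf.1.add hg.1, ((hf.2.add hg.2).const_mul 2).mono' ?_ ?_⟩
    · have h1 := hf.1.continuous
      have h2 := hg.1.continuous
      have h3 : Continuous (fun z => f z + g z) := h1.add h2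
      have h4 : Continuous (fun z => ‖f z + g z‖ ^ 2 * Real.exp (-‖z‖ ^ 2 / 2)) :=
        (h3.norm.pow 2).mul (by fun_prop)
      exact h4.aestronglyMeasurable
    · refine Filter.Eventually.of_forall fun z => ?_
      have he := Real.exp_pos (-‖z‖ ^ 2 / 2)
      simp only [Pi.add_apply, norm_mul, norm_pow, Real.norm_eq_abs, abs_of_pos he, abs_norm]
      have h := norm_add_le (f z) (g z)
      have : ‖f z + g z‖ ^ 2 ≤ 2 * (‖f z‖ ^ 2 + ‖g z‖ ^ 2) := by
        nlinarith [sq_nonneg (‖f z‖ - ‖g z‖), norm_nonneg (f z + g z)]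
      nlinarith
  smul_mem' := by
    intro c f hf
    refine ⟨hf.1.const_smul c, ?_⟩
    have := hf.2.const_mul (‖c‖ ^ 2)
    refine this.congr (Filter.Eventually.of_forall fun z => ?_)
    simp only [Pi.smul_apply, norm_smul]
    ring

/-- The Fock space `F(ℂ^d)`. It carries the norm of the inner product below,
not the topology of pointwise convergence. -/
def Fock (d : ℕ) : Type := ↥(fockSubmodule d)

namespace Fock

noncomputable instance (d : ℕ) : AddCommGroup (Fock d) :=
  inferInstanceAs (AddCommGroup ↥(fockSubmodule d))

noncomputable instance (d : ℕ) : Module ℂ (Fock d) :=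
  inferInstanceAs (Module ℂ ↥(fockSubmodule d))

instance (d : ℕ) : CoeFun (Fock d) (fun _ => CSpace d → ℂ) := ⟨fun f => f.1⟩

@[ext] theorem ext {d : ℕ} {f g : Fock d} (h : ∀ z, f z = g z) : f = g :=
  Subtype.ext (funext h)

@[simp] theorem add_apply {d : ℕ} (f g : Fock d) (z : CSpace d) : (f + g) z = f z + g z := rfl

@[simp] theorem smul_apply {d : ℕ} (c : ℂ) (f : Fock d) (z : CSpace d) :
    (c • f) z = c * f z := rfl

@[simp] theorem zero_apply {d : ℕ} (z : CSpace d) : (0 : Fock d) z = 0 := rfl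

/-- `(2π)^{-d} ∫ conj (f z) g(z) e^{-|z|²/2} dA(z)`: linear in the second variable, as
is usual in Mathlib. -/
noncomputable def fockInner {d : ℕ} (f g : Fock d) : ℂ :=
  (((2 * Real.pi) ^ d)⁻¹ : ℝ) *
    ∫ z : CSpace d, (starRingEnd ℂ) (f z) * g z * (Real.exp (-‖z‖ ^ 2 / 2) : ℂ)

theorem fockInner_self {d : ℕ} (f : Fock d) :
    fockInner f f = ((((2 * Real.pi) ^ d)⁻¹ *
      ∫ z : CSpace d, ‖f z‖ ^ 2 * Real.exp (-‖z‖ ^ 2 / 2) : ℝ) : ℂ) := by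
  rw [fockInner, Complex.ofReal_mul, ← integral_complex_ofReal]
  congr 2
  funext z
  rw [Complex.conj_mul']
  push_cast
  rfl

noncomputable abbrev core (d : ℕ) : InnerProductSpace.Core ℂ (Fock d) where
  inner := fockInner
  conj_inner_symm f g := by
    change (starRingEnd ℂ) (fockInner g f) = fockInner f g
    rw [fockInner, fockInner, map_mul, Complex.conj_ofReal, ← integral_conj]
    congr 2
    funext z
    simp only [map_mul, Complex.conj_conj, Complex.conj_ofReal]
    ring
  re_inner_nonneg f := by
    rw [fockInner_self]
    simp only [RCLike.re_to_complex, Complex.ofReal_re]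
    have : 0 ≤ ∫ z : CSpace d, ‖f z‖ ^ 2 * Real.exp (-‖z‖ ^ 2 / 2) :=
      integral_nonneg fun z => by positivity
    positivity
  add_left f g h := by
    change fockInner (f + g) h = fockInner f h + fockInner g h
    rw [fockInner, fockInner, fockInner, ← mul_add,
      ← integral_add (fock_integrable_mul f.2 h.2) (fock_integrable_mul g.2 h.2)]
    congr 2
    funext z
    simp only [add_apply, map_add]
    ring
  smul_left f g c := by
    change fockInner (c • f) g = (starRingEnd ℂ) c * fockInner f g
    rw [fockInner, fockInner, mul_left_comm, ← integral_const_mul ((starRingEnd ℂ) c)]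
    congr 2
    funext z
    simp only [smul_apply, map_mul]
    ring
  definite f hf := by
    change fockInner f f = 0 at hf
    rw [fockInner_self, Complex.ofReal_eq_zero] at hf
    have hpi : (((2 * Real.pi) ^ d)⁻¹ : ℝ) ≠ 0 := by positivity
    have h0 := (mul_eq_zero.mp hf).resolve_left hpi
    have hc : Continuous (fun z : CSpace d => ‖f z‖ ^ 2 * Real.exp (-‖z‖ ^ 2 / 2)) := by
      have h1 := f.2.1.continuous
      fun_prop
    have h2 := (integral_eq_zero_iff_of_nonneg (fun z => by positivity) f.2.2).mp h0
    have h3 := (hc.ae_eq_iff_eq volume continuous_zero).mp h2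
    ext z
    have h4 := congrFun h3 z
    simpa using h4

noncomputable instance (d : ℕ) : NormedAddCommGroup (Fock d) :=
  (core d).toNormedAddCommGroup

noncomputable instance (d : ℕ) : InnerProductSpace ℂ (Fock d) :=
  InnerProductSpace.ofCore (core d).toCore

end Fock

/-- The affine map `z ↦ A z + b` of `ℂ^d`. -/
noncomputable def affineSymbol {d : ℕ} (A : Matrix (Fin d) (Fin d) ℂ) (b : CSpace d)
    (z : CSpace d) : CSpace d :=
  A.toEuclideanLin z + b

/-- The bounded operator `T` on the Fock space is the composition operator `f ↦ f ∘ φ`. -/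
def IsCompositionOperator {d : ℕ} (φ : CSpace d → CSpace d) (T : Fock d →L[ℂ] Fock d) : Prop :=
  ∀ (f : Fock d) (z : CSpace d), T f z = f (φ z)

/-- The `n`-th approximation number (`n ≥ 1`) of a bounded operator: its distance in operator
norm to the bounded operators of rank at most `n - 1`, that is, less than `n`. -/
noncomputable def approxNumber {X : Type*} [NormedAddCommGroup X] [NormedSpace ℂ X]
    (T : X →L[ℂ] X) (n : ℕ) : ℝ :=
  sInf {r : ℝ | ∃ S : X →L[ℂ] X, (S : X →ₗ[ℂ] X).rank < n ∧ r = ‖T - S‖}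

/-- The singular values of a square matrix, listed with multiplicity in some order. -/
def IsSingularValues {d : ℕ} (A : Matrix (Fin d) (Fin d) ℂ) (lam : Fin d → ℝ) : Prop :=
  ∃ σ : Equiv.Perm (Fin d), ∀ j, lam j = A.toEuclideanLin.singularValues (σ j)

/-- `λ^α = ∏ j, λ_j ^ α_j`, with `0 ^ 0 = 1`. -/
def multiPow {d : ℕ} (lam : Fin d → ℝ) (α : Fin d → ℕ) : ℝ := ∏ j, lam j ^ α j

section
open scoped MatrixOrder Matrix.Norms.L2Operator

/-- The positive semidefinite square root of `A A^*`. -/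
noncomputable def sqrtMulStar {d : ℕ} (A : Matrix (Fin d) (Fin d) ℂ) :
    Matrix (Fin d) (Fin d) ℂ :=
  CFC.sqrt (A * A.conjTranspose)

end

/-- `v = (I + B)⁻¹ b` with `B = √(A A^*)`. -/
noncomputable def vVec {d : ℕ} (A : Matrix (Fin d) (Fin d) ℂ) (b : CSpace d) : CSpace d :=
  (1 + sqrtMulStar A)⁻¹.toEuclideanLin b

/-- `exp (⟨(I - B)⁻¹ v, v⟩ / 2 - |v|² / 4)`. Mathlib's inner product is linear in the
second variable, so the arguments are exchanged. -/
noncomputable def approxConst {d : ℕ} (A : Matrix (Fin d) (Fin d) ℂ) (b : CSpace d) : ℂ :=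
  Complex.exp (inner ℂ (vVec A b) ((1 - sqrtMulStar A)⁻¹.toEuclideanLin (vVec A b)) / 2
    - (‖vVec A b‖ : ℂ) ^ 2 / 4)

/-!
The approximation numbers of an operator on an inner product space can be read off from a Schmidt
decomposition `T e_i = s_i g_i` with `e`, `g` orthonormal and `e` total: they are the numbers `s_i`
in nonincreasing order (`approxNumber_of_diagonal`). Only the density of the span of `e` is needed,
so that the completeness of the Fock space plays no role.

To find such a decomposition, write `A = P D R` with `P`, `R` unitary and `D` the diagonal matrix of
the singular values `λ_j` (`exists_singularValueDecomposition`). Composition with a unitary map is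
a unitary operator on the Fock space, and so is each Weyl operator
`W_u f(z) = f(z - u) exp(⟨z, u⟩ / 2 - |u|² / 4)`. With `c = P⁻¹ b`, `u = -(1 - D²)⁻¹ c` and
`p = -D u`, the composition operator with symbol `D z + c` is
`exp(⟨(1 - D²)⁻¹ c, c⟩ / 4) W_p C_D W_u`, where `C_D f(z) = f(D z)` multiplies the monomial `z ^ α`
by `λ ^ α`. Hence the monomials, moved by unitary operators, provide the decomposition
(`Fock.exists_orthonormal_diagonal`), and the numerical factor is the constant of the theorem since
`√(A A*) = P D P⁻¹` (`approxConst_eq`).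

The monomials are orthogonal because the Gaussian measure is invariant under rotations of the
coordinates. Their span is dense (`Fock.topologicalClosure_span_unitMonomial`): an entire function
is expanded in one coordinate after the other, the terms of each expansion are orthogonal on every
ball, and letting the radius grow bounds the tails in norm (`Fock.tendsto_sum_part`). That the terms
are again entire in all variables follows from Cauchy's formula on complex lines
(`differentiable_fderiv_apply`).

Finally `1 - D²` is invertible because compactness implies `λ_j < 1` (`Fock.singularValue_lt_one`):
otherwise the images of normalised kernel functions along a left singular vector would be bounded
below in norm and tend to zero pointwise, and no subsequence could converge.
-/

/-! ### Entire functions and their expansion in one coordinate -/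

/-- Multiplication of the `i`-th coordinate by `c i`. -/
noncomputable def coordMul {d : ℕ} (c : Fin d → ℂ) : CSpace d →L[ℂ] CSpace d :=
  LinearMap.toContinuousLinearMap
    { toFun := fun z => WithLp.toLp 2 fun i => c i * z i
      map_add' := fun z w => by ext i; simp [mul_add]
      map_smul' := fun a z => by ext i; simp [mul_left_comm] }

@[simp] theorem coordMul_apply {d : ℕ} (c : Fin d → ℂ) (z : CSpace d) (i : Fin d) :
    coordMul c z i = c i * z i := rfl

theorem coordMul_coordMul {d : ℕ} (a c : Fin d → ℂ) (z : CSpace d) :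
    coordMul a (coordMul c z) = coordMul (a * c) z := by
  ext i; simp [mul_assoc]

theorem norm_coordMul_le {d : ℕ} {c : Fin d → ℂ} {C : ℝ} (hC : ∀ i, ‖c i‖ ≤ C)
    (hC0 : 0 ≤ C) (z : CSpace d) : ‖coordMul c z‖ ≤ C * ‖z‖ := by
  refine le_of_sq_le_sq ?_ (by positivity)
  rw [mul_pow, EuclideanSpace.norm_sq_eq, EuclideanSpace.norm_sq_eq, Finset.mul_sum]
  refine Finset.sum_le_sum fun i _ => ?_
  rw [coordMul_apply, norm_mul, mul_pow]
  gcongr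
  exact hC i

/-- Multiplication of the `j`-th coordinate by `ζ`. -/
noncomputable abbrev coordScale {d : ℕ} (j : Fin d) (ζ : ℂ) : CSpace d →L[ℂ] CSpace d :=
  coordMul (Function.update 1 j ζ)

theorem coordScale_eq {d : ℕ} (j : Fin d) (ζ : ℂ) (z : CSpace d) :
    coordScale j ζ z = (z - EuclideanSpace.single j (z j)) + ζ • EuclideanSpace.single j (z j) := by
  ext i
  rcases eq_or_ne i j with rfl | h
  · simp
  · simp [h]

theorem coordScale_mul {d : ℕ} (j : Fin d) (a c : ℂ) (z : CSpace d) :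
    coordScale j a (coordScale j c z) = coordScale j (a * c) z := by
  rw [coordMul_coordMul]
  congr 2
  ext i
  rcases eq_or_ne i j with rfl | h
  · simp
  · simp [h]

theorem coordScale_comm {d : ℕ} (i j : Fin d) (a c : ℂ) (z : CSpace d) :
    coordScale i a (coordScale j c z) = coordScale j c (coordScale i a z) := by
  rw [coordMul_coordMul, coordMul_coordMul, mul_comm]

@[simp] theorem coordScale_one {d : ℕ} (j : Fin d) (z : CSpace d) : coordScale j 1 z = z := by
  ext i
  simp

theorem norm_coordScale_le {d : ℕ} (j : Fin d) {ζ : ℂ} {C : ℝ} (h1 : 1 ≤ C) (hζ : ‖ζ‖ ≤ C)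
    (z : CSpace d) : ‖coordScale j ζ z‖ ≤ C * ‖z‖ := by
  refine norm_coordMul_le (fun i => ?_) (by linarith) z
  rcases eq_or_ne i j with rfl | h
  · simpa using hζ
  · simpa [h] using h1

section Entire

variable {E : Type*} [NormedAddCommGroup E] [NormedSpace ℂ E]

theorem differentiable_comp_line {f : E → ℂ} (hf : Differentiable ℂ f) (z v : E) :
    Differentiable ℂ fun ζ : ℂ => f (z + ζ • v) :=
  hf.comp ((differentiable_const z).add (differentiable_id.smul_const v))

theorem hasDerivAt_comp_line {f : E → ℂ} (hf : Differentiable ℂ f) (z v : E) (ζ : ℂ) :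
    HasDerivAt (fun ζ : ℂ => f (z + ζ • v)) (fderiv ℂ f (z + ζ • v) v) ζ := by
  have h1 : HasDerivAt (fun ζ : ℂ => z + ζ • v) v ζ := by
    simpa using ((hasDerivAt_id ζ).smul_const v).const_add z
  exact (hf (z + ζ • v)).hasFDerivAt.comp_hasDerivAt ζ h1

/-- Cauchy's estimate along complex lines. -/
theorem norm_fderiv_le_of_entire {f : E → ℂ} (hf : Differentiable ℂ f) {z : E} {C : ℝ}
    (hC : ∀ w, ‖w - z‖ ≤ 1 → ‖f w‖ ≤ C) : ‖fderiv ℂ f z‖ ≤ C := by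
  have hC0 : 0 ≤ C := (norm_nonneg _).trans (hC z (by simp))
  refine ContinuousLinearMap.opNorm_le_of_unit_norm hC0 fun v hv => ?_
  have h := (hasDerivAt_comp_line hf z v 0).deriv
  rw [zero_smul, add_zero] at h
  rw [← h]
  have := Complex.norm_deriv_le_of_forall_mem_sphere_norm_le (c := 0) (C := C) one_pos
    (differentiable_comp_line hf z v).diffContOnCl (fun ζ hζ => hC _ ?_)
  · simpa using this
  · have : ‖ζ‖ = 1 := by simpa using hζ
    simp [norm_smul, this, hv]

variable [FiniteDimensional ℂ E]

/-- Directional derivatives of an entire function are entire: Cauchy's integral formula on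
the complex line through `z` may be differentiated in `z` under the integral sign. -/
theorem differentiable_fderiv_apply {f : E → ℂ} (hf : Differentiable ℂ f) (v : E) :
    Differentiable ℂ fun z => fderiv ℂ f z v := by
  borelize E
  have hformula : (fun z => fderiv ℂ f z v) = fun z => (2 * Real.pi * Complex.I : ℂ)⁻¹ *
      ∫ θ in (0 : ℝ)..2 * Real.pi,
        deriv (circleMap 0 1) θ * ((circleMap 0 1 θ) ^ 2)⁻¹ * f (z + circleMap 0 1 θ • v) := by
    funext z
    have h := (hasDerivAt_comp_line hf z v 0).deriv
    rw [zero_smul, add_zero] at h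
    rw [← h, ← Complex.two_pi_I_inv_smul_circleIntegral_sub_sq_inv_smul_of_differentiable
      isOpen_univ (Set.subset_univ (Metric.closedBall (0 : ℂ) 1))
      (differentiable_comp_line hf z v).differentiableOn (Metric.mem_ball_self one_pos)]
    simp only [circleIntegral, smul_eq_mul, sub_zero, mul_assoc]
  rw [hformula]
  refine Differentiable.const_mul (fun z₀ => ?_) _
  have : ProperSpace E := FiniteDimensional.proper ℂ E
  obtain ⟨C, hC⟩ := (isCompact_closedBall z₀ (‖v‖ + 2)).exists_bound_of_continuousOn
    hf.continuous.continuousOn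
  have hcont : ∀ z, Continuous fun θ : ℝ =>
      deriv (circleMap 0 1) θ * ((circleMap 0 1 θ) ^ 2)⁻¹ * f (z + circleMap 0 1 θ • v) := by
    intro z
    have h1 : Continuous fun θ : ℝ => circleMap 0 1 θ := continuous_circleMap 0 1
    have h2 : Continuous fun θ : ℝ => ((circleMap 0 1 θ) ^ 2)⁻¹ :=
      (h1.pow 2).inv₀ fun θ => pow_ne_zero _ (circleMap_ne_center one_ne_zero)
    have h3 : Continuous (deriv (circleMap 0 1)) := by
      have : deriv (circleMap 0 1) = fun θ : ℝ => circleMap 0 1 θ * Complex.I := by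
        funext θ; exact deriv_circleMap 0 1 θ
      rw [this]; fun_prop
    have h4 := hf.continuous
    exact (h3.mul h2).mul (h4.comp (by fun_prop))
  have hnorm : ∀ θ : ℝ, ‖deriv (circleMap 0 1) θ * ((circleMap 0 1 θ) ^ 2)⁻¹‖ = 1 := by
    intro θ; simp
  -- the derivative is bounded near the circle because `f` is bounded on a slightly larger ball
  have hfd : ∀ θ : ℝ, ∀ z ∈ Metric.ball z₀ 1, ‖fderiv ℂ f (z + circleMap 0 1 θ • v)‖ ≤ C := by
    intro θ z hz
    refine norm_fderiv_le_of_entire hf fun w hw => hC w ?_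
    rw [mem_ball_iff_norm] at hz
    rw [mem_closedBall_iff_norm]
    have h1 : ‖circleMap 0 1 θ • v‖ = ‖v‖ := by simp [norm_smul]
    calc ‖w - z₀‖ = ‖(w - (z + circleMap 0 1 θ • v)) + circleMap 0 1 θ • v + (z - z₀)‖ := by
          congr 1; abel
      _ ≤ ‖w - (z + circleMap 0 1 θ • v)‖ + ‖circleMap 0 1 θ • v‖ + ‖z - z₀‖ :=
          norm_add₃_le
      _ ≤ ‖v‖ + 2 := by linarith
  simp only [intervalIntegral.integral_of_le Real.two_pi_pos.le]
  refine (hasFDerivAt_integral_of_dominated_of_fderiv_le (bound := fun _ => C)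
    (F' := fun z θ => (deriv (circleMap 0 1) θ * ((circleMap 0 1 θ) ^ 2)⁻¹) •
      fderiv ℂ f (z + circleMap 0 1 θ • v)) (Metric.ball_mem_nhds z₀ one_pos)
    (Filter.Eventually.of_forall fun z => (hcont z).aestronglyMeasurable)
    ?_ ?_ ?_ ?_ ?_).differentiableAt
  · exact ((hcont z₀).integrableOn_Ioc)
  · refine AEStronglyMeasurable.smul (f := fun θ =>
        deriv (circleMap 0 1) θ * ((circleMap 0 1 θ) ^ 2)⁻¹)
        (g := fun θ => fderiv ℂ f (z₀ + circleMap 0 1 θ • v)) ?_ ?_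
    · have h1 : Continuous fun θ : ℝ => circleMap 0 1 θ := continuous_circleMap 0 1
      have h2 : Continuous fun θ : ℝ => ((circleMap 0 1 θ) ^ 2)⁻¹ :=
        (h1.pow 2).inv₀ fun θ => pow_ne_zero _ (circleMap_ne_center one_ne_zero)
      simp only [deriv_circleMap]
      exact ((h1.mul continuous_const).mul h2).aestronglyMeasurable
    · have h1 : Continuous fun θ : ℝ => z₀ + circleMap 0 1 θ • v := by fun_prop
      have : SecondCountableTopology (E →L[ℂ] ℂ) :=
        have : ProperSpace (E →L[ℂ] ℂ) := FiniteDimensional.proper ℂ _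
        inferInstance
      exact ((measurable_fderiv ℂ f).comp h1.measurable).aestronglyMeasurable
  · refine Filter.Eventually.of_forall fun θ z hz => ?_
    rw [norm_smul, hnorm, one_mul]
    exact hfd θ z hz
  · exact integrableOn_const (by simp [ENNReal.mul_eq_top])
  · refine Filter.Eventually.of_forall fun θ z _ => ?_
    have h1 : HasFDerivAt (fun z => z + circleMap 0 1 θ • v) (ContinuousLinearMap.id ℂ E) z :=
      (hasFDerivAt_id z).add_const _
    exact (((hf _).hasFDerivAt.comp z h1)).const_mul _

end Entire

section Components

variable {d : ℕ}

theorem differentiable_comp_coordScale {f : CSpace d → ℂ} (hf : Differentiable ℂ f) (j : Fin d)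
    (z : CSpace d) : Differentiable ℂ fun ζ : ℂ => f (coordScale j ζ z) := by
  simp only [coordScale_eq]
  exact differentiable_comp_line hf _ _

/-- The part of `f` that is homogeneous of degree `m` in the `j`-th coordinate: the `m`-th term
of the Taylor expansion of `ζ ↦ f (z₁, …, ζ z_j, …, z_d)` at the origin, taken at `ζ = 1`. -/
noncomputable def coordPart (f : CSpace d → ℂ) (j : Fin d) (m : ℕ) (z : CSpace d) : ℂ :=
  (m.factorial : ℂ)⁻¹ * iteratedDeriv m (fun ζ : ℂ => f (coordScale j ζ z)) 0

theorem hasSum_coordPart {f : CSpace d → ℂ} (hf : Differentiable ℂ f) (j : Fin d)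
    (z : CSpace d) : HasSum (fun m => coordPart f j m z) (f z) := by
  have h := Complex.hasSum_taylorSeries_of_entire (differentiable_comp_coordScale hf j z) 0 1
  simpa [coordPart] using h

theorem coordPart_coordScale {f : CSpace d → ℂ} (hf : Differentiable ℂ f) (j : Fin d) (m : ℕ)
    (ζ : ℂ) (z : CSpace d) : coordPart f j m (coordScale j ζ z) = ζ ^ m * coordPart f j m z := by
  have h := congrFun (iteratedDeriv_comp_const_mul
    ((differentiable_comp_coordScale hf j z).contDiff (n := m)) ζ) 0
  simp only [mul_comm ζ] at h
  simp only [coordPart, coordScale_mul]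
  rw [h, zero_mul]
  ring

theorem coordPart_coordScale_of_ne {f : CSpace d → ℂ} {i j : Fin d} {a m : ℕ}
    (hi : ∀ (ζ : ℂ) z, f (coordScale i ζ z) = ζ ^ a * f z)
    (ζ : ℂ) (z : CSpace d) : coordPart f j m (coordScale i ζ z) = ζ ^ a * coordPart f j m z := by
  simp only [coordPart, coordScale_comm j i, hi]
  rw [iteratedDeriv_const_mul_field]
  ring

/-- Cauchy's estimate on the circle of radius two, which gives the parts a geometric bound on
every ball. -/
theorem norm_coordPart_le {f : CSpace d → ℂ} (hf : Differentiable ℂ f) (j : Fin d) (m : ℕ)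
    {R C : ℝ} (hC : ∀ w, ‖w‖ ≤ 2 * R → ‖f w‖ ≤ C) {z : CSpace d} (hz : ‖z‖ ≤ R) :
    ‖coordPart f j m z‖ ≤ C * (1 / 2) ^ m := by
  have h := Complex.norm_iteratedDeriv_le_of_forall_mem_sphere_norm_le (c := 0) (R := 2) (C := C) m
    two_pos (differentiable_comp_coordScale hf j z).diffContOnCl (fun ζ hζ => hC _ ?_)
  · rw [coordPart, norm_mul, norm_inv, Complex.norm_natCast]
    have : (0 : ℝ) < m.factorial := by positivity
    calc (m.factorial : ℝ)⁻¹ * _ ≤ (m.factorial : ℝ)⁻¹ * (m.factorial * C / 2 ^ m) := by gcongr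
      _ = C * (1 / 2) ^ m := by rw [one_div, inv_pow]; field_simp
  · have : ‖ζ‖ = 2 := by simpa using hζ
    exact (norm_coordScale_le j one_le_two this.le z).trans (by linarith)

theorem differentiable_coordPart {f : CSpace d → ℂ} (hf : Differentiable ℂ f) (j : Fin d)
    (m : ℕ) : Differentiable ℂ (coordPart f j m) := by
  -- iterated derivatives along the scaling are `z_j ^ m` times iterated partial derivatives
  have key : ∀ m : ℕ, ∃ g : CSpace d → ℂ, Differentiable ℂ g ∧ ∀ z,
      iteratedDeriv m (fun ζ : ℂ => f (coordScale j ζ z)) =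
        fun ζ => z j ^ m * g (coordScale j ζ z) := by
    intro m
    induction m with
    | zero => exact ⟨f, hf, fun z => by simp⟩
    | succ m ih =>
      obtain ⟨g, hg, hgz⟩ := ih
      refine ⟨fun z => fderiv ℂ g z (EuclideanSpace.single j 1),
        differentiable_fderiv_apply hg _, fun z => ?_⟩
      rw [iteratedDeriv_succ, hgz]
      funext ζ
      have h := ((hasDerivAt_comp_line hg (z - EuclideanSpace.single j (z j))
        (EuclideanSpace.single j (z j)) ζ).const_mul (z j ^ m)).deriv
      simp only [← coordScale_eq] at h
      have hs : (EuclideanSpace.single j (z j) : CSpace d) = z j • EuclideanSpace.single j 1 := by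
        ext i; simp
      rw [h, hs, map_smul, smul_eq_mul]
      ring
  obtain ⟨g, hg, hgz⟩ := key m
  have : coordPart f j m = fun z => (m.factorial : ℂ)⁻¹ * (z j ^ m * g (coordScale j 0 z)) := by
    funext z
    rw [coordPart, hgz]
  rw [this]
  have h1 : Differentiable ℂ fun z : CSpace d => g (coordScale j 0 z) :=
    hg.comp (coordScale j 0).differentiable
  have h2 : Differentiable ℂ fun z : CSpace d => z j := by fun_prop
  fun_prop

/-- A function homogeneous in every coordinate is a multiple of a monomial. -/
theorem eq_mul_prod_of_homogeneous {f : CSpace d → ℂ} {α : Fin d → ℕ}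
    (h : ∀ j (ζ : ℂ) z, f (coordScale j ζ z) = ζ ^ α j * f z) (z : CSpace d) :
    f z = f (WithLp.toLp 2 1) * ∏ j, z j ^ α j := by
  classical
  have key : ∀ s : Finset (Fin d), f (WithLp.toLp 2 fun i => if i ∈ s then z i else 1) =
      f (WithLp.toLp 2 1) * ∏ j ∈ s, z j ^ α j := by
    intro s
    induction s using Finset.induction_on with
    | empty => simp; rfl
    | insert j s hj ih =>
      rw [Finset.prod_insert hj, mul_left_comm, ← ih, ← h]
      congr 1
      ext i
      rcases eq_or_ne i j with rfl | hij
      · simp [hj]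
      · simp [hij]
  have := key Finset.univ
  simpa using this

end Components

/-! ### Unitary operators and monomials in the Fock space -/

section Rotation

variable {d : ℕ}

/-- Multiplication of the coordinates by complex numbers of modulus one, as an isometry. -/
noncomputable def coordRotation (c : Fin d → ℂ) (hc : ∀ i, ‖c i‖ = 1) :
    CSpace d ≃ₗᵢ[ℂ] CSpace d :=
  LinearIsometry.toLinearIsometryEquiv
    { toLinearMap := (coordMul c).toLinearMap
      norm_map' := fun z => by
        rw [← sq_eq_sq₀ (norm_nonneg _) (norm_nonneg _), EuclideanSpace.norm_sq_eq,
          EuclideanSpace.norm_sq_eq]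
        simp [hc] } rfl

theorem LinearIsometryEquiv.measurePreserving_complex (L : CSpace d ≃ₗᵢ[ℂ] CSpace d) :
    MeasurePreserving L volume volume :=
  LinearIsometryEquiv.measurePreserving
    ({ L.toLinearEquiv.restrictScalars ℝ with norm_map' := L.norm_map } : CSpace d ≃ₗᵢ[ℝ] CSpace d)

/-- Functions of different degrees of homogeneity in the `j`-th coordinate are orthogonal on every
unitarily invariant set, as the rotation of that coordinate by a suitable angle changes the sign
of the integral. -/
theorem setIntegral_conj_mul_eq_zero_of_homogeneous {f g : CSpace d → ℂ} {j : Fin d} {a b : ℕ}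
    (hab : a ≠ b) (hf : ∀ (ζ : ℂ) z, f (coordScale j ζ z) = ζ ^ a * f z)
    (hg : ∀ (ζ : ℂ) z, g (coordScale j ζ z) = ζ ^ b * g z) {s : Set (CSpace d)}
    (hs : ∀ L : CSpace d ≃ₗᵢ[ℂ] CSpace d, L ⁻¹' s = s) :
    ∫ z in s, (starRingEnd ℂ) (f z) * g z * (Real.exp (-‖z‖ ^ 2 / 2) : ℂ) = 0 := by
  obtain ⟨ω, hω, hωab⟩ : ∃ ω : ℂ, ‖ω‖ = 1 ∧ (starRingEnd ℂ) ω ^ a * ω ^ b = -1 := by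
    have hne : ((b : ℂ) - a) ≠ 0 := sub_ne_zero.mpr (by exact_mod_cast hab.symm)
    refine ⟨Complex.exp ((Real.pi / ((b : ℝ) - a) : ℝ) * Complex.I),
      Complex.norm_exp_ofReal_mul_I _, ?_⟩
    rw [← Complex.exp_conj, ← Complex.exp_nat_mul, ← Complex.exp_nat_mul, ← Complex.exp_add,
      ← Complex.exp_pi_mul_I]
    congr 1
    simp only [map_mul, Complex.conj_ofReal, Complex.conj_I]
    push_cast
    field_simp
    ring
  have hc : ∀ i, ‖Function.update (1 : Fin d → ℂ) j ω i‖ = 1 := by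
    intro i
    rcases eq_or_ne i j with rfl | h
    · simpa using hω
    · simp [h]
  set L := coordRotation _ hc
  have h := (L.measurePreserving_complex).setIntegral_preimage_emb
    L.toHomeomorph.measurableEmbedding
    (fun z => (starRingEnd ℂ) (f z) * g z * (Real.exp (-‖z‖ ^ 2 / 2) : ℂ)) s
  rw [hs] at h
  have h2 : ∀ z, (starRingEnd ℂ) (f (L z)) * g (L z) * (Real.exp (-‖L z‖ ^ 2 / 2) : ℂ) =
      -((starRingEnd ℂ) (f z) * g z * (Real.exp (-‖z‖ ^ 2 / 2) : ℂ)) := by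
    intro z
    rw [L.norm_map, show L z = coordScale j ω z from rfl, hf, hg, map_mul, map_pow]
    linear_combination ((starRingEnd ℂ) (f z) * g z * (Real.exp (-‖z‖ ^ 2 / 2) : ℂ)) * hωab
  simp only [h2] at h
  rw [integral_neg] at h
  exact self_eq_neg.mp h.symm

end Rotation

namespace Fock

variable {d : ℕ}

theorem inner_def (f g : Fock d) : inner ℂ f g = fockInner f g := rfl

theorem norm_sq_eq (f : Fock d) : ‖f‖ ^ 2 =
    ((2 * Real.pi) ^ d)⁻¹ * ∫ z : CSpace d, ‖f z‖ ^ 2 * Real.exp (-‖z‖ ^ 2 / 2) := by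
  have h := inner_self_eq_norm_sq_to_K (𝕜 := ℂ) f
  rw [inner_def, fockInner_self] at h
  exact Complex.ofReal_injective ((Complex.ofReal_pow _ _).trans h.symm)

theorem norm_eq_of_integral_eq {f g : Fock d}
    (h : ∫ z : CSpace d, ‖f z‖ ^ 2 * Real.exp (-‖z‖ ^ 2 / 2) =
      ∫ z : CSpace d, ‖g z‖ ^ 2 * Real.exp (-‖z‖ ^ 2 / 2)) : ‖f‖ = ‖g‖ := by
  rw [← sq_eq_sq₀ (norm_nonneg _) (norm_nonneg _), norm_sq_eq, norm_sq_eq, h]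

@[simp] theorem sub_apply (f g : Fock d) (z : CSpace d) : (f - g) z = f z - g z := rfl

/-- Evaluation at a point, as a linear functional. -/
noncomputable def evalLinear (z : CSpace d) : Fock d →ₗ[ℂ] ℂ where
  toFun f := f z
  map_add' _ _ := rfl
  map_smul' _ _ := rfl

theorem sum_apply {ι : Type*} (s : Finset ι) (f : ι → Fock d) (z : CSpace d) :
    (∑ i ∈ s, f i) z = ∑ i ∈ s, f i z :=
  map_sum (evalLinear z) f s

/-- Composition with a unitary map, as a map of the Fock space into itself. -/
noncomputable def compLinear (L : CSpace d ≃ₗᵢ[ℂ] CSpace d) : Fock d →ₗ[ℂ] Fock d where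
  toFun f := ⟨fun z => f (L z), f.2.1.comp L.toContinuousLinearEquiv.differentiable, by
    have h := (L.measurePreserving_complex.integrable_comp_emb
      L.toHomeomorph.measurableEmbedding).mpr f.2.2
    simpa only [Function.comp_def, L.norm_map] using h⟩
  map_add' _ _ := rfl
  map_smul' _ _ := rfl

/-- Composition with a unitary map is a unitary operator on the Fock space. -/
noncomputable def compUnitary (L : CSpace d ≃ₗᵢ[ℂ] CSpace d) : Fock d ≃ₗᵢ[ℂ] Fock d where
  toLinearEquiv := LinearEquiv.ofLinearMap (compLinear L) (compLinear L.symm)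
    (by ext f z; exact congrArg f.1 (L.symm_apply_apply z))
    (by ext f z; exact congrArg f.1 (L.apply_symm_apply z))
  norm_map' f := norm_eq_of_integral_eq (by
    have h := L.measurePreserving_complex.integral_comp L.toHomeomorph.measurableEmbedding
      (fun z => ‖f z‖ ^ 2 * Real.exp (-‖z‖ ^ 2 / 2))
    simp only [L.norm_map] at h
    exact h)

@[simp] theorem compUnitary_apply (L : CSpace d ≃ₗᵢ[ℂ] CSpace d) (f : Fock d) (z : CSpace d) :
    compUnitary L f z = f (L z) := rfl

@[simp] theorem compUnitary_symm_apply (L : CSpace d ≃ₗᵢ[ℂ] CSpace d) (f : Fock d)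
    (z : CSpace d) : (compUnitary L).symm f z = f (L.symm z) := rfl

/-- The factor `exp(⟨z, u⟩ / 2 - |u|² / 4)` of the Weyl operators. Mathlib's inner product is linear
in the second variable, so the arguments are exchanged. -/
noncomputable def weylFactor (u z : CSpace d) : ℂ :=
  Complex.exp (inner ℂ u z / 2 - (‖u‖ : ℂ) ^ 2 / 4)

theorem differentiable_weylFactor (u : CSpace d) : Differentiable ℂ (weylFactor u) := by
  have h : Differentiable ℂ fun z : CSpace d => inner ℂ u z := (innerSL ℂ u).differentiable
  unfold weylFactor
  fun_prop

/-- The Weyl factor turns the Gaussian weight centred at the origin into the one centred at `u`,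
which is why the Weyl operators are isometries. -/
theorem norm_weylFactor_sq_mul (u z : CSpace d) :
    ‖weylFactor u z‖ ^ 2 * Real.exp (-‖z‖ ^ 2 / 2) = Real.exp (-‖z - u‖ ^ 2 / 2) := by
  rw [weylFactor, Complex.norm_exp, ← Real.exp_nat_mul, ← Real.exp_add]
  congr 1
  have h1 : ((inner ℂ u z / 2 - (‖u‖ : ℂ) ^ 2 / 4 : ℂ)).re
      = (inner ℂ u z : ℂ).re / 2 - ‖u‖ ^ 2 / 4 := by
    rw [Complex.sub_re, show ((‖u‖ : ℂ) ^ 2 / 4) = ((‖u‖ ^ 2 / 4 : ℝ) : ℂ) by push_cast; rfl,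
      Complex.ofReal_re, Complex.div_ofNat_re]
  have h2 := norm_sub_sq (𝕜 := ℂ) u z
  rw [norm_sub_rev] at h2
  rw [h1, h2]
  simp only [RCLike.re_to_complex]
  push_cast
  ring

theorem weyl_integrand (u : CSpace d) (f : CSpace d → ℂ) (z : CSpace d) :
    ‖f (z - u) * weylFactor u z‖ ^ 2 * Real.exp (-‖z‖ ^ 2 / 2) =
      ‖f (z - u)‖ ^ 2 * Real.exp (-‖z - u‖ ^ 2 / 2) := by
  rw [norm_mul, mul_pow, mul_assoc, norm_weylFactor_sq_mul]

/-- The Weyl operator `f ↦ f(z - u) exp(⟨z, u⟩ / 2 - |u|² / 4)`, as a linear map. -/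
noncomputable def weylLinear (u : CSpace d) : Fock d →ₗ[ℂ] Fock d where
  toFun f := ⟨fun z => f (z - u) * weylFactor u z,
    (f.2.1.comp (differentiable_id.sub_const u)).mul (differentiable_weylFactor u), by
      simp only [weyl_integrand]
      exact f.2.2.comp_sub_right u⟩
  map_add' f g := by ext z; exact add_mul _ _ _
  map_smul' a f := by ext z; exact mul_assoc _ _ _

theorem weylLinear_apply (u : CSpace d) (f : Fock d) (z : CSpace d) :
    weylLinear u f z = f (z - u) * weylFactor u z := rfl

theorem weylLinear_neg_apply (u : CSpace d) (f : Fock d) :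
    weylLinear (-u) (weylLinear u f) = f := by
  ext z
  rw [weylLinear_apply, weylLinear_apply, sub_neg_eq_add, add_sub_cancel_right, mul_assoc,
    weylFactor, weylFactor, ← Complex.exp_add, inner_add_right, inner_neg_left, norm_neg,
    inner_self_eq_norm_sq_to_K]
  convert mul_one (f z)
  rw [← Complex.exp_zero]
  congr 1
  simp only [Complex.coe_algebraMap]
  ring

/-- The Weyl operators are unitary. -/
noncomputable def weyl (u : CSpace d) : Fock d ≃ₗᵢ[ℂ] Fock d where
  toLinearEquiv := LinearEquiv.ofLinearMap (weylLinear u) (weylLinear (-u))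
    (LinearMap.ext fun f => by simpa using weylLinear_neg_apply (-u) f)
    (LinearMap.ext fun f => weylLinear_neg_apply u f)
  norm_map' f := norm_eq_of_integral_eq (by
    change ∫ z, ‖f (z - u) * weylFactor u z‖ ^ 2 * Real.exp (-‖z‖ ^ 2 / 2) = _
    simp only [weyl_integrand]
    exact integral_sub_right_eq_self (fun z => ‖f z‖ ^ 2 * Real.exp (-‖z‖ ^ 2 / 2)) u)

theorem weyl_apply (u : CSpace d) (f : Fock d) (z : CSpace d) :
    weyl u f z = f (z - u) * weylFactor u z := rfl

theorem integrable_exp_neg_norm_sq_div_four :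
    Integrable fun z : CSpace d => Real.exp (-‖z‖ ^ 2 / 4) := by
  have h := (GaussianFourier.integrable_cexp_neg_mul_sq_norm_add (b := 1 / 4) (by norm_num) 0
    (0 : CSpace d)).norm
  refine h.congr (Filter.Eventually.of_forall fun z => ?_)
  simp only [Complex.norm_exp, zero_mul, add_zero]
  congr 1
  rw [show (-(1 / 4) * (‖z‖ : ℂ) ^ 2) = ((-‖z‖ ^ 2 / 4 : ℝ) : ℂ) by push_cast; ring,
    Complex.ofReal_re]

/-- Entire functions of polynomial growth belong to the Fock space. -/
theorem mem_fockSet_of_polynomial_growth {f : CSpace d → ℂ} (hf : Differentiable ℂ f) (n : ℕ)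
    (h : ∀ z, ‖f z‖ ≤ ‖z‖ ^ n) : f ∈ fockSet d := by
  refine ⟨hf, (integrable_exp_neg_norm_sq_div_four.const_mul ((4 : ℝ) ^ n * n.factorial)).mono'
    ?_ (Filter.Eventually.of_forall fun z => ?_)⟩
  · have := hf.continuous
    exact Continuous.aestronglyMeasurable (by fun_prop)
  · rw [Real.norm_of_nonneg (by positivity)]
    have h1 : ‖f z‖ ^ 2 ≤ (‖z‖ ^ 2) ^ n := by
      rw [pow_right_comm]
      exact pow_le_pow_left₀ (norm_nonneg _) (h z) 2
    have h2 : (‖z‖ ^ 2 / 4) ^ n / n.factorial ≤ Real.exp (‖z‖ ^ 2 / 4) :=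
      Real.pow_div_factorial_le_exp _ (by positivity) n
    have h3 : (‖z‖ ^ 2) ^ n ≤ (4 : ℝ) ^ n * n.factorial * Real.exp (‖z‖ ^ 2 / 4) := by
      rw [div_pow, div_div, div_le_iff₀ (by positivity)] at h2
      linarith
    calc ‖f z‖ ^ 2 * Real.exp (-‖z‖ ^ 2 / 2)
        ≤ ((4 : ℝ) ^ n * n.factorial * Real.exp (‖z‖ ^ 2 / 4)) * Real.exp (-‖z‖ ^ 2 / 2) := by
          gcongr
          exact h1.trans h3
      _ = (4 : ℝ) ^ n * n.factorial * Real.exp (-‖z‖ ^ 2 / 4) := by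
          rw [mul_assoc, ← Real.exp_add]
          congr 2
          ring

/-- The monomial `z ^ α`. -/
noncomputable def monomial (α : Fin d → ℕ) : Fock d :=
  ⟨fun z => ∏ j, z j ^ α j, mem_fockSet_of_polynomial_growth
    (by
      intro z
      exact (HasFDerivAt.finsetProd (g := fun j (z : CSpace d) => z j ^ α j) fun j _ =>
        (show DifferentiableAt ℂ (fun z : CSpace d => z j ^ α j) z by
          fun_prop).hasFDerivAt).differentiableAt) (∑ j, α j) fun z => by
    rw [norm_prod, ← Finset.prod_pow_eq_pow_sum]
    refine Finset.prod_le_prod (fun _ _ => norm_nonneg _) fun j _ => ?_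
    rw [norm_pow]
    exact pow_le_pow_left₀ (norm_nonneg _) (PiLp.norm_apply_le z j) _⟩

theorem monomial_apply (α : Fin d → ℕ) (z : CSpace d) : monomial α z = ∏ j, z j ^ α j := rfl

theorem monomial_coordMul (α : Fin d → ℕ) (c : Fin d → ℂ) (z : CSpace d) :
    monomial α (coordMul c z) = (∏ j, c j ^ α j) * monomial α z := by
  simp [monomial_apply, mul_pow, Finset.prod_mul_distrib]

theorem monomial_coordScale (α : Fin d → ℕ) (j : Fin d) (ζ : ℂ) (z : CSpace d) :
    monomial α (coordScale j ζ z) = ζ ^ α j * monomial α z := by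
  rw [monomial_coordMul]
  congr 1
  rw [Finset.prod_eq_single j]
  · simp
  · intro i _ hi
    simp [hi]
  · simp

theorem monomial_ne_zero (α : Fin d → ℕ) : monomial α ≠ 0 := by
  intro h
  have h1 : monomial α (WithLp.toLp 2 1) = 0 := by rw [h]; rfl
  simp [monomial_apply] at h1

theorem inner_monomial_of_ne {α β : Fin d → ℕ} (h : α ≠ β) :
    inner ℂ (monomial α) (monomial β) = 0 := by
  obtain ⟨j, hj⟩ := Function.ne_iff.mp h
  have := setIntegral_conj_mul_eq_zero_of_homogeneous hj (monomial_coordScale α j)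
    (monomial_coordScale β j) (s := Set.univ) (fun L => rfl)
  rw [setIntegral_univ] at this
  rw [inner_def, fockInner, this, mul_zero]

/-- The monomials, normalised in the Fock norm. -/
noncomputable def unitMonomial (α : Fin d → ℕ) : Fock d :=
  ((‖monomial α‖⁻¹ : ℝ) : ℂ) • monomial α

theorem unitMonomial_def (α : Fin d → ℕ) :
    unitMonomial α = ((‖monomial α‖⁻¹ : ℝ) : ℂ) • monomial α := rfl

theorem orthonormal_unitMonomial : Orthonormal ℂ (unitMonomial (d := d)) := by
  refine ⟨fun α => ?_, fun α β h => ?_⟩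
  · have : ‖monomial α‖ ≠ 0 := norm_ne_zero_iff.mpr (monomial_ne_zero α)
    rw [unitMonomial_def, norm_smul, Complex.norm_real, norm_inv, norm_norm, inv_mul_cancel₀ this]
  · change inner ℂ (unitMonomial α) (unitMonomial β) = 0
    rw [unitMonomial_def, unitMonomial_def, inner_smul_left, inner_smul_right,
      inner_monomial_of_ne h]
    simp

theorem unitMonomial_coordMul (α : Fin d → ℕ) (c : Fin d → ℂ) (z : CSpace d) :
    unitMonomial α (coordMul c z) = (∏ j, c j ^ α j) * unitMonomial α z := by
  simp only [unitMonomial_def, smul_apply, monomial_coordMul]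
  ring

end Fock

/-! ### Density of the polynomials -/

namespace Fock

variable {d : ℕ}

/-- The integral of `|g|² e^{-|z|²/2}` over the closed ball of radius `R`. -/
noncomputable def ballIntegral (R : ℝ) (g : CSpace d → ℂ) : ℝ :=
  ∫ z in Metric.closedBall (0 : CSpace d) R, ‖g z‖ ^ 2 * Real.exp (-‖z‖ ^ 2 / 2)

theorem ballIntegral_nonneg (R : ℝ) (g : CSpace d → ℂ) : 0 ≤ ballIntegral R g :=
  integral_nonneg fun z => by positivity

theorem ballIntegral_le (R : ℝ) {g : CSpace d → ℂ} (hg : g ∈ fockSet d) :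
    ballIntegral R g ≤ ∫ z : CSpace d, ‖g z‖ ^ 2 * Real.exp (-‖z‖ ^ 2 / 2) :=
  setIntegral_le_integral hg.2 (Filter.Eventually.of_forall fun z => by positivity)

theorem tendsto_ballIntegral {g : CSpace d → ℂ} (hg : g ∈ fockSet d) :
    Filter.Tendsto (fun n : ℕ => ballIntegral n g) Filter.atTop
      (nhds (∫ z : CSpace d, ‖g z‖ ^ 2 * Real.exp (-‖z‖ ^ 2 / 2))) :=
  (aecover_closedBall tendsto_natCast_atTop_atTop).integral_tendsto_of_countably_generated hg.2

theorem mem_fockSet_of_ballIntegral_le {g : CSpace d → ℂ} (hg : Differentiable ℂ g) {C : ℝ}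
    (h : ∀ n : ℕ, ballIntegral n g ≤ C) : g ∈ fockSet d := by
  have hc := hg.continuous
  refine ⟨hg, (aecover_closedBall (x := (0 : CSpace d))
    tendsto_natCast_atTop_atTop).integrable_of_integral_norm_bounded C (fun n => ?_)
    (Filter.Eventually.of_forall fun n => ?_)⟩
  · exact (Continuous.continuousOn (by fun_prop)).integrableOn_compact (isCompact_closedBall _ _)
  · refine le_of_eq_of_le (integral_congr_ae (Filter.Eventually.of_forall fun z => ?_)) (h n)
    exact Real.norm_of_nonneg (by positivity)

/-- Pythagoras on balls, for functions of distinct degrees of homogeneity in one coordinate. -/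
theorem ballIntegral_sum {F : ℕ → CSpace d → ℂ} (hF : ∀ m, Continuous (F m)) {j : Fin d}
    (hFj : ∀ m (ζ : ℂ) z, F m (coordScale j ζ z) = ζ ^ m * F m z) (R : ℝ) (s : Finset ℕ) :
    ballIntegral R (fun z => ∑ m ∈ s, F m z) = ∑ m ∈ s, ballIntegral R (F m) := by
  have hint : ∀ m k, IntegrableOn (fun z => (starRingEnd ℂ) (F m z) * F k z *
      (Real.exp (-‖z‖ ^ 2 / 2) : ℂ)) (Metric.closedBall 0 R) := by
    intro m k
    have h1 := hF m
    have h2 := hF k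
    exact (Continuous.continuousOn (by fun_prop)).integrableOn_compact (isCompact_closedBall _ _)
  have hofReal : ∀ g : CSpace d → ℂ, (ballIntegral R g : ℂ) =
      ∫ z in Metric.closedBall (0 : CSpace d) R,
        (starRingEnd ℂ) (g z) * g z * (Real.exp (-‖z‖ ^ 2 / 2) : ℂ) := by
    intro g
    rw [ballIntegral, ← integral_complex_ofReal]
    congr 1
    funext z
    rw [Complex.conj_mul']
    push_cast
    rfl
  apply Complex.ofReal_injective
  push_cast
  simp only [hofReal, map_sum, Finset.sum_mul, Finset.mul_sum]
  rw [integral_finsetSum _ fun m _ => integrable_finsetSum _ fun k _ => hint k m]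
  refine Finset.sum_congr rfl fun m hm => ?_
  rw [integral_finsetSum _ fun k _ => hint k m, Finset.sum_eq_single m]
  · intro k _ hkm
    exact setIntegral_conj_mul_eq_zero_of_homogeneous hkm (hFj k) (hFj m)
      fun L => by ext z; simp
  · exact fun h => absurd hm h

/-- On a ball the expansion in one coordinate converges in mean square, by dominated convergence.
By Pythagoras the mean squares of its finite segments are the sums on the left. -/
theorem tendsto_ballIntegral_coordPart {f : CSpace d → ℂ} (hf : Differentiable ℂ f) (j : Fin d)
    (R : ℝ) (N : ℕ) :
    Filter.Tendsto (fun M => ∑ m ∈ Finset.Ico N M, ballIntegral R (coordPart f j m))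
      Filter.atTop
      (nhds (ballIntegral R fun z => f z - ∑ m ∈ Finset.range N, coordPart f j m z)) := by
  have hcont := fun m => (differentiable_coordPart hf j m).continuous
  obtain ⟨C, hC⟩ := (isCompact_closedBall (0 : CSpace d) (2 * R)).exists_bound_of_continuousOn
    hf.continuous.continuousOn
  simp only [mem_closedBall_zero_iff] at hC
  have hbound : ∀ M, ∀ z ∈ Metric.closedBall (0 : CSpace d) R,
      ‖∑ m ∈ Finset.Ico N M, coordPart f j m z‖ ≤ C * 2 := by
    intro M z hz
    rw [mem_closedBall_zero_iff] at hz
    have hC0 : 0 ≤ C := (norm_nonneg _).trans (hC z (by linarith [norm_nonneg z]))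
    calc ‖∑ m ∈ Finset.Ico N M, coordPart f j m z‖
        ≤ ∑ m ∈ Finset.Ico N M, C * (1 / 2) ^ m :=
          norm_sum_le_of_le _ fun m _ => norm_coordPart_le hf j m hC hz
      _ = C * ∑ m ∈ Finset.Ico N M, (1 / 2 : ℝ) ^ m := (Finset.mul_sum _ _ _).symm
      _ ≤ C * ∑' m : ℕ, (1 / 2 : ℝ) ^ m := by
          gcongr
          exact summable_geometric_two.sum_le_tsum _ fun _ _ => by positivity
      _ = C * 2 := by rw [tsum_geometric_two]
  simp only [← ballIntegral_sum hcont (coordPart_coordScale hf j)]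
  refine tendsto_integral_of_dominated_convergence (fun _ => (C * 2) ^ 2) (fun M => ?_) ?_
    (fun M => ?_) (Filter.Eventually.of_forall fun z => ?_)
  · exact Continuous.aestronglyMeasurable (by fun_prop)
  · exact integrableOn_const (measure_closedBall_lt_top).ne
  · refine (ae_restrict_iff' measurableSet_closedBall).mpr
      (Filter.Eventually.of_forall fun z hz => ?_)
    rw [Real.norm_of_nonneg (by positivity)]
    have h1 : Real.exp (-‖z‖ ^ 2 / 2) ≤ 1 := Real.exp_le_one_iff.mpr (by
      have := sq_nonneg ‖z‖
      linarith)
    have h2 := pow_le_pow_left₀ (norm_nonneg _) (hbound M z hz) 2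
    calc _ ≤ (C * 2) ^ 2 * 1 := by gcongr
      _ = _ := mul_one _
  · have h1 := (hasSum_coordPart hf j z).tendsto_sum_nat.sub_const
      (∑ m ∈ Finset.range N, coordPart f j m z)
    have h2 : Filter.Tendsto (fun M => ∑ m ∈ Finset.Ico N M, coordPart f j m z) Filter.atTop
        (nhds (f z - ∑ m ∈ Finset.range N, coordPart f j m z)) := by
      refine h1.congr' ?_
      filter_upwards [Filter.eventually_ge_atTop N] with M hM
      exact (Finset.sum_Ico_eq_sub _ hM).symm
    exact (h2.norm.pow 2).mul_const _

/-- Bessel's inequality on balls, with a bound that does not depend on the radius. -/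
theorem sum_ballIntegral_coordPart_le (f : Fock d) (j : Fin d) (R : ℝ) (M : ℕ) :
    ∑ m ∈ Finset.range M, ballIntegral R (coordPart f j m) ≤
      ∫ z : CSpace d, ‖f z‖ ^ 2 * Real.exp (-‖z‖ ^ 2 / 2) := by
  have h := tendsto_ballIntegral_coordPart f.2.1 j R 0
  simp only [Finset.range_zero, Finset.sum_empty, sub_zero, Nat.Ico_zero_eq_range] at h
  refine (Monotone.ge_of_tendsto (fun a b hab => ?_) h M).trans (ballIntegral_le R f.2)
  exact Finset.sum_le_sum_of_subset_of_nonneg (Finset.range_subset_range.mpr hab)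
    fun _ _ _ => ballIntegral_nonneg R _

/-- The part of `f` that is homogeneous of degree `m` in the `j`-th coordinate, as an element of
the Fock space. -/
noncomputable def part (f : Fock d) (j : Fin d) (m : ℕ) : Fock d :=
  ⟨coordPart f j m, mem_fockSet_of_ballIntegral_le (differentiable_coordPart f.2.1 j m)
    fun n => (Finset.single_le_sum (f := fun m => ballIntegral n (coordPart f j m))
      (fun _ _ => ballIntegral_nonneg _ _)
      (Finset.self_mem_range_succ m)).trans (sum_ballIntegral_coordPart_le f j n (m + 1))⟩

/-- The expansion in one coordinate converges in the norm of the Fock space. Pythagoras on balls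
bounds the tails of the expansion uniformly in the radius. -/
theorem tendsto_sum_part (f : Fock d) (j : Fin d) :
    Filter.Tendsto (fun N => ∑ m ∈ Finset.range N, part f j m) Filter.atTop (nhds f) := by
  set a : ℕ → ℝ := fun m => ∫ z : CSpace d, ‖part f j m z‖ ^ 2 * Real.exp (-‖z‖ ^ 2 / 2)
  have ha0 : ∀ m, 0 ≤ a m := fun m => integral_nonneg fun z => by positivity
  have ha : Summable a := summable_of_sum_range_le ha0 fun M =>
    le_of_tendsto (tendsto_finsetSum _ fun m _ => tendsto_ballIntegral (part f j m).2)
      (Filter.Eventually.of_forall fun n => sum_ballIntegral_coordPart_le f j n M)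
  have htail : ∀ N, ‖f - ∑ m ∈ Finset.range N, part f j m‖ ^ 2 ≤
      ((2 * Real.pi) ^ d)⁻¹ * ∑' m, a (m + N) := by
    intro N
    rw [norm_sq_eq]
    refine mul_le_mul_of_nonneg_left ?_ (by positivity)
    refine le_of_tendsto (tendsto_ballIntegral (f - ∑ m ∈ Finset.range N, part f j m).2)
      (Filter.Eventually.of_forall fun n => ?_)
    have h := tendsto_ballIntegral_coordPart f.2.1 j n N
    have heq : (f - ∑ m ∈ Finset.range N, part f j m).1 =
        fun z => f z - ∑ m ∈ Finset.range N, coordPart f j m z := by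
      funext z
      rw [sub_apply, sum_apply]
      rfl
    rw [heq]
    refine le_of_tendsto h (Filter.Eventually.of_forall fun M => ?_)
    calc ∑ m ∈ Finset.Ico N M, ballIntegral n (coordPart f j m)
        ≤ ∑ m ∈ Finset.Ico N M, a m :=
          Finset.sum_le_sum fun m _ => ballIntegral_le n (part f j m).2
      _ = ∑ m ∈ Finset.range (M - N), a (m + N) := by
          rw [Finset.sum_Ico_eq_sum_range]
          simp only [add_comm]
      _ ≤ _ := ((summable_nat_add_iff N).mpr ha).sum_le_tsum _ fun m _ => ha0 _
  rw [tendsto_iff_norm_sub_tendsto_zero]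
  have h0 : Filter.Tendsto (fun N => ((2 * Real.pi) ^ d)⁻¹ * ∑' m, a (m + N)) Filter.atTop
      (nhds 0) := by
    simpa using (tendsto_sum_nat_add a).const_mul ((2 * Real.pi) ^ d)⁻¹
  have h1 := squeeze_zero (fun N => sq_nonneg _) htail h0
  have h2 := h1.sqrt
  simp only [Real.sqrt_zero, Real.sqrt_sq (norm_nonneg _)] at h2
  simpa only [norm_sub_rev] using h2

/-- The elements of the Fock space that are homogeneous in each of the coordinates in `s`. -/
def homogeneousIn (s : Finset (Fin d)) : Set (Fock d) :=
  {f | ∀ j ∈ s, ∃ a : ℕ, ∀ (ζ : ℂ) z, f (coordScale j ζ z) = ζ ^ a * f z}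

theorem topologicalClosure_span_homogeneousIn (s : Finset (Fin d)) :
    (Submodule.span ℂ (homogeneousIn s)).topologicalClosure = ⊤ := by
  induction s using Finset.induction_on with
  | empty =>
    have : homogeneousIn (∅ : Finset (Fin d)) = Set.univ := by
      ext f; simp [homogeneousIn]
    rw [this, Submodule.span_univ]
    exact eq_top_iff.mpr (Submodule.le_topologicalClosure _)
  | insert j s _ ih =>
    rw [eq_top_iff, ← ih]
    refine Submodule.topologicalClosure_minimal _ (Submodule.span_le.mpr fun f hf => ?_)
      (Submodule.isClosed_topologicalClosure _)
    refine mem_closure_of_tendsto (tendsto_sum_part f j)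
      (Filter.Eventually.of_forall fun N => Submodule.sum_mem _ fun m _ =>
        Submodule.subset_span fun i hi => ?_)
    rcases Finset.mem_insert.mp hi with rfl | hi
    · exact ⟨m, coordPart_coordScale f.2.1 i m⟩
    · obtain ⟨a, ha⟩ := hf i hi
      exact ⟨a, coordPart_coordScale_of_ne ha⟩

/-- The polynomials are dense in the Fock space. -/
theorem topologicalClosure_span_unitMonomial :
    (Submodule.span ℂ (Set.range (unitMonomial (d := d)))).topologicalClosure = ⊤ := by
  rw [eq_top_iff, ← topologicalClosure_span_homogeneousIn Finset.univ]
  refine Submodule.topologicalClosure_mono (Submodule.span_le.mpr fun f hf => ?_)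
  choose α hα using fun j => hf j (Finset.mem_univ j)
  have h : f = (f (WithLp.toLp 2 1) * (‖monomial α‖ : ℂ)) • unitMonomial α := by
    have hne : (‖monomial α‖ : ℂ) ≠ 0 :=
      Complex.ofReal_ne_zero.mpr (norm_ne_zero_iff.mpr (monomial_ne_zero α))
    ext z
    rw [unitMonomial_def, smul_apply, smul_apply, eq_mul_prod_of_homogeneous hα z, monomial_apply]
    push_cast
    field_simp
  rw [h]
  exact Submodule.smul_mem _ _ (Submodule.subset_span ⟨α, rfl⟩)

end Fock

/-! ### Approximation numbers of diagonal operators -/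

section ApproxNumber

variable {X ι : Type*} [NormedAddCommGroup X] [InnerProductSpace ℂ X]

theorem Orthonormal.norm_sum_smul_sq {v : ι → X} (hv : Orthonormal ℂ v) (l : ι → ℂ)
    (s : Finset ι) : ‖∑ i ∈ s, l i • v i‖ ^ 2 = ∑ i ∈ s, ‖l i‖ ^ 2 := by
  have h := hv.inner_sum l l s
  rw [inner_self_eq_norm_sq_to_K] at h
  simp only [Complex.conj_mul'] at h
  apply Complex.ofReal_injective
  push_cast
  exact h

/-- An operator that is diagonal with respect to two orthonormal systems, the first of which is
total, is bounded by the supremum of the moduli of its diagonal entries. -/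
theorem ContinuousLinearMap.opNorm_le_of_diagonal {T : X →L[ℂ] X} {e g : ι → X}
    (he : Orthonormal ℂ e) (hg : Orthonormal ℂ g)
    (htotal : (Submodule.span ℂ (Set.range e)).topologicalClosure = ⊤) {t : ι → ℝ}
    (hT : ∀ i, T (e i) = (t i : ℂ) • g i) {C : ℝ} (hC : ∀ i, |t i| ≤ C) (hC0 : 0 ≤ C) :
    ‖T‖ ≤ C := by
  refine T.opNorm_le_bound hC0 fun x => ?_
  have hclosed : IsClosed {x | ‖T x‖ ≤ C * ‖x‖} :=
    isClosed_le (by fun_prop) (by fun_prop)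
  have hspan : ∀ x ∈ Submodule.span ℂ (Set.range e), ‖T x‖ ≤ C * ‖x‖ := by
    intro x hx
    obtain ⟨l, rfl⟩ := (Finsupp.mem_span_range_iff_exists_finsupp).mp hx
    refine le_of_sq_le_sq ?_ (by positivity)
    have h1 : T (l.sum fun i a => a • e i) = ∑ i ∈ l.support, (l i * (t i : ℂ)) • g i := by
      simp only [Finsupp.sum, map_sum, map_smul, hT, smul_smul]
    rw [h1, hg.norm_sum_smul_sq, mul_pow, Finsupp.sum, he.norm_sum_smul_sq, Finset.mul_sum]
    refine Finset.sum_le_sum fun i _ => ?_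
    rw [norm_mul, mul_pow, Complex.norm_real, mul_comm]
    gcongr
    exact hC i
  have hx : x ∈ closure (Submodule.span ℂ (Set.range e) : Set X) := by
    rw [← Submodule.topologicalClosure_coe, htotal]
    trivial
  exact closure_minimal hspan hclosed hx

/-- If `T e_i = s_i g_i` for orthonormal systems `e` and `g`, the first of which is total, then the
approximation numbers of `T` are the numbers `s_i` in nonincreasing order. The best approximation
of rank `n` keeps the `n` largest terms; conversely, an operator of rank at most `n` kills a unit
vector in the span of the first `n + 1` vectors `e_i`. -/
theorem approxNumber_of_diagonal {T : X →L[ℂ] X} {e g : ι → X}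
    (he : Orthonormal ℂ e) (hg : Orthonormal ℂ g)
    (htotal : (Submodule.span ℂ (Set.range e)).topologicalClosure = ⊤) {s : ι → ℝ}
    (hs : ∀ i, 0 ≤ s i) (hT : ∀ i, T (e i) = (s i : ℂ) • g i) {α : ℕ → ι}
    (hα : Function.Injective α) (hrange : ∀ i, i ∉ Set.range α → s i = 0)
    (hanti : Antitone fun n => s (α n)) (n : ℕ) : approxNumber T (n + 1) = s (α n) := by
  classical
  have hlower : ∀ S : X →L[ℂ] X, (S : X →ₗ[ℂ] X).rank < ((n + 1 : ℕ) : Cardinal) →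
      s (α n) ≤ ‖T - S‖ := by
    intro S hS
    -- `n + 1` vectors in the range of `S` are linearly dependent
    have hdep : ¬ LinearIndependent ℂ fun k : Fin (n + 1) => S (e (α k)) := by
      intro hind
      have h1 : LinearIndependent ℂ fun k : Fin (n + 1) =>
          (⟨S (e (α k)), e (α k), rfl⟩ : LinearMap.range (S : X →ₗ[ℂ] X)) :=
        LinearIndependent.of_comp (LinearMap.range (S : X →ₗ[ℂ] X)).subtype hind
      have h2 := h1.cardinal_lift_le_rank
      rw [Cardinal.mk_fin, Cardinal.lift_natCast, Cardinal.lift_uzero] at h2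
      exact absurd hS (not_lt.mpr h2)
    obtain ⟨c, hc, k₀, hk₀⟩ := Fintype.not_linearIndependent_iff.mp hdep
    have heα : Orthonormal ℂ fun k : Fin (n + 1) => e (α k) :=
      he.comp (fun k : Fin (n + 1) => α k) (hα.comp Fin.val_injective)
    have hgα : Orthonormal ℂ fun k : Fin (n + 1) => g (α k) :=
      hg.comp (fun k : Fin (n + 1) => α k) (hα.comp Fin.val_injective)
    set x : X := ∑ k : Fin (n + 1), c k • e (α k)
    have hSx : S x = 0 := by simpa [x] using hc
    have hTx : T x = ∑ k : Fin (n + 1), (c k * (s (α k) : ℂ)) • g (α k) := by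
      simp only [x, map_sum, map_smul, hT, smul_smul]
    have hx : ‖x‖ ^ 2 = ∑ k, ‖c k‖ ^ 2 := heα.norm_sum_smul_sq c Finset.univ
    have hx0 : 0 < ‖x‖ := by
      refine (norm_nonneg x).lt_of_ne' (sq_pos_iff.mp ?_)
      rw [hx]
      exact Finset.sum_pos' (fun k _ => sq_nonneg _)
        ⟨k₀, Finset.mem_univ _, pow_pos (norm_pos_iff.mpr hk₀) 2⟩
    have hle : s (α n) * ‖x‖ ≤ ‖(T - S) x‖ := by
      refine le_of_sq_le_sq ?_ (norm_nonneg _)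
      rw [_root_.sub_apply, hSx, sub_zero, hTx, hgα.norm_sum_smul_sq, mul_pow, hx,
        Finset.mul_sum]
      refine Finset.sum_le_sum fun k _ => ?_
      rw [norm_mul, mul_pow, Complex.norm_real, Real.norm_of_nonneg (hs _), mul_comm]
      have h1 : s (α n) ≤ s (α k) := hanti (Nat.lt_succ_iff.mp k.2)
      have h2 := hs (α n)
      gcongr
    exact le_of_mul_le_mul_right (hle.trans ((T - S).le_opNorm x)) hx0
  let S : X →L[ℂ] X := ∑ k ∈ Finset.range n,
    (s (α k) : ℂ) • (innerSL ℂ (e (α k))).smulRight (g (α k))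
  have hSapply : ∀ x, S x =
      ∑ k ∈ Finset.range n, (s (α k) : ℂ) • (inner ℂ (e (α k)) x • g (α k)) := by
    intro x
    simp [S]
  -- the range of `S` lies in the span of `n` vectors
  have hrank : (S : X →ₗ[ℂ] X).rank < ((n + 1 : ℕ) : Cardinal) := by
    have hsub : LinearMap.range (S : X →ₗ[ℂ] X) ≤
        Submodule.span ℂ (((Finset.range n).image fun k => g (α k) : Finset X) : Set X) := by
      rintro _ ⟨x, rfl⟩
      change S x ∈ _
      rw [hSapply]
      refine Submodule.sum_mem _ fun k hk => Submodule.smul_mem _ _ (Submodule.smul_mem _ _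
        (Submodule.subset_span ?_))
      exact Finset.mem_coe.mpr (Finset.mem_image_of_mem _ hk)
    calc (S : X →ₗ[ℂ] X).rank
        ≤ (((Finset.range n).image fun k => g (α k)).card : Cardinal) :=
          (Submodule.rank_mono hsub).trans (rank_span_finset_le _)
      _ ≤ (n : Cardinal) := by
          exact_mod_cast Finset.card_image_le.trans_eq (Finset.card_range n)
      _ < ((n + 1 : ℕ) : Cardinal) := by exact_mod_cast n.lt_succ_self
  have hupper : ‖T - S‖ ≤ s (α n) := by
    refine ContinuousLinearMap.opNorm_le_of_diagonal he hg htotal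
      (t := fun i => if i ∈ (Finset.range n).image α then 0 else s i) (fun i => ?_) (fun i => ?_)
      (hs _)
    · have hS : S (e i) = if i ∈ (Finset.range n).image α then (s i : ℂ) • g i else 0 := by
        rw [hSapply]
        simp only [orthonormal_iff_ite.mp he]
        split_ifs with hi
        · obtain ⟨m, hm, rfl⟩ := Finset.mem_image.mp hi
          rw [Finset.sum_eq_single_of_mem m hm]
          · simp
          · intro k _ hk
            simp [hα.ne hk]
        · refine Finset.sum_eq_zero fun k hk => ?_
          have : α k ≠ i := fun h => hi (h ▸ Finset.mem_image_of_mem α hk)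
          simp [this]
      rw [_root_.sub_apply, hS, hT]
      split_ifs <;> simp
    · split_ifs with hi
      · simpa using hs _
      · rw [abs_of_nonneg (hs i)]
        by_cases hir : i ∈ Set.range α
        · obtain ⟨m, rfl⟩ := hir
          refine hanti (not_lt.mp fun hm => hi ?_)
          exact Finset.mem_image_of_mem α (Finset.mem_range.mpr hm)
        · rw [hrange i hir]
          exact hs _
  have hbdd : BddBelow {r : ℝ | ∃ S : X →L[ℂ] X,
      (S : X →ₗ[ℂ] X).rank < ((n + 1 : ℕ) : Cardinal) ∧ r = ‖T - S‖} := by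
    refine ⟨0, ?_⟩
    rintro _ ⟨R, _, rfl⟩
    exact norm_nonneg _
  refine le_antisymm ((csInf_le hbdd ⟨S, hrank, rfl⟩).trans hupper)
    (le_csInf ⟨_, S, hrank, rfl⟩ ?_)
  · rintro _ ⟨R, hR, rfl⟩
    exact hlower R hR

end ApproxNumber

/-! ### Singular value decomposition and the constant -/

section SVD

variable {d : ℕ}

theorem singularValues_nonneg {A : Matrix (Fin d) (Fin d) ℂ} {lam : Fin d → ℝ}
    (hlam : IsSingularValues A lam) (j : Fin d) : 0 ≤ lam j := by
  obtain ⟨σ, hσ⟩ := hlam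
  rw [hσ]
  exact LinearMap.singularValues_nonneg _ _

/-- The singular value decomposition, with the coordinates in two orthonormal bases as the
unitary maps. -/
theorem exists_singularValueDecomposition {A : Matrix (Fin d) (Fin d) ℂ} {lam : Fin d → ℝ}
    (hlam : IsSingularValues A lam) : ∃ P R : CSpace d ≃ₗᵢ[ℂ] CSpace d,
      ∀ z, A.toEuclideanLin z = P (coordMul (fun j => (lam j : ℂ)) (R z)) := by
  have hnonneg := singularValues_nonneg hlam
  obtain ⟨σ, hσ⟩ := hlam
  set L := A.toEuclideanLin
  have hd : Module.finrank ℂ (CSpace d) = d := by simp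
  set x : OrthonormalBasis (Fin d) ℂ (CSpace d) :=
    (L.isSymmetric_adjoint_comp_self.eigenvectorBasis hd).reindex σ.symm
  have hx : ∀ j, L.adjoint (L (x j)) = ((lam j ^ 2 : ℝ) : ℂ) • x j := by
    intro j
    have h := L.isSymmetric_adjoint_comp_self.apply_eigenvectorBasis hd (σ j)
    rw [hσ, LinearMap.sq_singularValues_fin L hd]
    simp only [x, OrthonormalBasis.reindex_apply, Equiv.symm_symm]
    exact h
  have hinner : ∀ i j, inner ℂ (L (x i)) (L (x j)) =
      if i = j then ((lam j ^ 2 : ℝ) : ℂ) else 0 := by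
    intro i j
    rw [← LinearMap.adjoint_inner_right, hx, inner_smul_right, orthonormal_iff_ite.mp x.orthonormal]
    simp
  -- where `λ_j = 0` the left singular vectors are an arbitrary completion to a basis
  obtain ⟨y, hy⟩ := Orthonormal.exists_orthonormalBasis_extension_of_card_eq (𝕜 := ℂ)
    (E := CSpace d) (ι := Fin d) (by simp) (v := fun j => ((lam j : ℂ))⁻¹ • L (x j))
    (s := {j | lam j ≠ 0}) (by
      rw [orthonormal_iff_ite]
      rintro ⟨i, hi⟩ ⟨j, hj⟩
      have hi' : (lam i : ℂ) ≠ 0 := Complex.ofReal_ne_zero.mpr hi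
      simp only [Set.domRestrict_apply, inner_smul_left, inner_smul_right, hinner,
        Subtype.mk.injEq]
      split_ifs with h
      · subst h
        simp only [map_inv₀, Complex.conj_ofReal]
        push_cast
        field_simp
      · simp)
  have hLx : ∀ j, L (x j) = (lam j : ℂ) • y j := by
    intro j
    by_cases hj : lam j = 0
    · rw [hj, Complex.ofReal_zero, zero_smul, ← inner_self_eq_zero (𝕜 := ℂ), hinner]
      simp [hj]
    · have hj' : (lam j : ℂ) ≠ 0 := Complex.ofReal_ne_zero.mpr hj
      rw [hy j hj, smul_smul, mul_inv_cancel₀ hj', one_smul]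
  refine ⟨y.repr.symm, x.repr, fun z => ?_⟩
  conv_lhs => rw [← x.sum_repr z]
  rw [map_sum, ← y.sum_repr (y.repr.symm _)]
  refine Finset.sum_congr rfl fun j _ => ?_
  rw [map_smul, hLx, LinearIsometryEquiv.apply_symm_apply, coordMul_apply, smul_smul, mul_comm]

theorem inner_coordMul_left (c : Fin d → ℂ) (z w : CSpace d) :
    inner ℂ (coordMul c z) w = inner ℂ z (coordMul (star c) w) := by
  simp only [PiLp.inner_apply, coordMul_apply, RCLike.inner_apply, map_mul]
  refine Finset.sum_congr rfl fun i _ => ?_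
  simp only [Pi.star_apply, RCLike.star_def]
  ring

/-- The matrix that is diagonal, with entries `c`, in the orthonormal basis formed by the
columns of the unitary `P`. -/
noncomputable def conjDiagonal (P : CSpace d ≃ₗᵢ[ℂ] CSpace d) (c : Fin d → ℂ) :
    Matrix (Fin d) (Fin d) ℂ :=
  Matrix.toEuclideanLin.symm
    (P.toLinearEquiv.toLinearMap ∘ₗ (coordMul c).toLinearMap ∘ₗ P.symm.toLinearEquiv.toLinearMap)

theorem toEuclideanLin_conjDiagonal (P : CSpace d ≃ₗᵢ[ℂ] CSpace d) (c : Fin d → ℂ)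
    (z : CSpace d) : (conjDiagonal P c).toEuclideanLin z = P (coordMul c (P.symm z)) := by
  rw [conjDiagonal, LinearEquiv.apply_symm_apply]
  rfl

theorem toEuclideanLin_mul_apply (M N : Matrix (Fin d) (Fin d) ℂ) (z : CSpace d) :
    (M * N).toEuclideanLin z = M.toEuclideanLin (N.toEuclideanLin z) := by
  simp [Matrix.toEuclideanLin, Matrix.toLpLin_apply]

theorem conjDiagonal_mul (P : CSpace d ≃ₗᵢ[ℂ] CSpace d) (a c : Fin d → ℂ) :
    conjDiagonal P a * conjDiagonal P c = conjDiagonal P (a * c) := by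
  apply Matrix.toEuclideanLin.injective
  ext1 z
  rw [toEuclideanLin_mul_apply, toEuclideanLin_conjDiagonal, toEuclideanLin_conjDiagonal,
    toEuclideanLin_conjDiagonal, P.symm_apply_apply, coordMul_coordMul]

theorem conjDiagonal_one (P : CSpace d ≃ₗᵢ[ℂ] CSpace d) : conjDiagonal P 1 = 1 := by
  apply Matrix.toEuclideanLin.injective
  ext1 z
  have : coordMul (1 : Fin d → ℂ) (P.symm z) = P.symm z := by ext i; simp
  rw [toEuclideanLin_conjDiagonal, this, P.apply_symm_apply]
  simp [Matrix.toEuclideanLin]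

theorem conjDiagonal_add (P : CSpace d ≃ₗᵢ[ℂ] CSpace d) (a c : Fin d → ℂ) :
    conjDiagonal P (a + c) = conjDiagonal P a + conjDiagonal P c := by
  apply Matrix.toEuclideanLin.injective
  ext1 z
  rw [map_add, LinearMap.add_apply, toEuclideanLin_conjDiagonal, toEuclideanLin_conjDiagonal,
    toEuclideanLin_conjDiagonal, ← map_add]
  congr 1
  ext i
  simp [add_mul]

theorem conjDiagonal_inv (P : CSpace d ≃ₗᵢ[ℂ] CSpace d) {c : Fin d → ℂ} (hc : ∀ i, c i ≠ 0) :
    (conjDiagonal P c)⁻¹ = conjDiagonal P c⁻¹ := by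
  refine Matrix.inv_eq_right_inv ?_
  rw [conjDiagonal_mul, ← conjDiagonal_one P]
  congr 1
  ext i
  simp [hc i]

section
open scoped MatrixOrder Matrix.Norms.L2Operator

theorem sqrtMulStar_eq_conjDiagonal {A : Matrix (Fin d) (Fin d) ℂ} {lam : Fin d → ℝ}
    (hlam : ∀ j, 0 ≤ lam j) {P R : CSpace d ≃ₗᵢ[ℂ] CSpace d}
    (hA : ∀ z, A.toEuclideanLin z = P (coordMul (fun j => (lam j : ℂ)) (R z))) :
    sqrtMulStar A = conjDiagonal P fun j => (lam j : ℂ) := by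
  have hstar : star (fun j => (lam j : ℂ)) = fun j => (lam j : ℂ) := by
    ext j; simp
  have hAdj : ∀ w, A.conjTranspose.toEuclideanLin w =
      R.symm (coordMul (fun j => (lam j : ℂ)) (P.symm w)) := by
    intro w
    rw [Matrix.toEuclideanLin_conjTranspose_eq_adjoint]
    refine ext_inner_left ℂ fun z => ?_
    rw [LinearMap.adjoint_inner_right, hA, ← P.symm.inner_map_map, P.symm_apply_apply,
      inner_coordMul_left, hstar, ← R.inner_map_map z, R.apply_symm_apply]
  refine CFC.sqrt_unique ?_ ?_
  · apply Matrix.toEuclideanLin.injective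
    ext1 z
    rw [conjDiagonal_mul, toEuclideanLin_conjDiagonal, toEuclideanLin_mul_apply, hAdj, hA,
      R.apply_symm_apply, coordMul_coordMul]
  · rw [Matrix.nonneg_iff_posSemidef, ← Matrix.isPositive_toEuclideanLin_iff]
    refine ⟨fun z w => ?_, fun z => ?_⟩
    · rw [toEuclideanLin_conjDiagonal, toEuclideanLin_conjDiagonal, ← P.symm.inner_map_map,
        P.symm_apply_apply, inner_coordMul_left, hstar, ← P.symm.inner_map_map z,
        P.symm_apply_apply]
    · rw [toEuclideanLin_conjDiagonal, ← P.symm.inner_map_map, P.symm_apply_apply,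
        PiLp.inner_apply, map_sum]
      refine Finset.sum_nonneg fun i _ => ?_
      rw [coordMul_apply, RCLike.inner_apply, (starRingEnd ℂ).map_mul, Complex.conj_ofReal,
        mul_left_comm,
        Complex.mul_conj]
      simp only [RCLike.re_to_complex, ← Complex.ofReal_mul, Complex.ofReal_re]
      exact mul_nonneg (hlam i) (Complex.normSq_nonneg _)

end

/-- The value of the constant in the coordinates given by the singular value decomposition. -/
theorem approxConst_eq {A : Matrix (Fin d) (Fin d) ℂ} {lam : Fin d → ℝ}
    (hlam : ∀ j, 0 ≤ lam j) (hlam1 : ∀ j, lam j < 1) {P R : CSpace d ≃ₗᵢ[ℂ] CSpace d}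
    (hA : ∀ z, A.toEuclideanLin z = P (coordMul (fun j => (lam j : ℂ)) (R z))) (b : CSpace d) :
    approxConst A b =
      (Real.exp (∑ j, ‖P.symm b j‖ ^ 2 / (4 * (1 - lam j ^ 2))) : ℂ) := by
  have hp : ∀ j, (1 + lam j : ℂ) ≠ 0 := fun j => by
    have : (1 + lam j : ℝ) ≠ 0 := by linarith [hlam j]
    exact_mod_cast this
  have hm : ∀ j, (1 - lam j : ℂ) ≠ 0 := fun j => by
    have : (1 - lam j : ℝ) ≠ 0 := by linarith [hlam1 j]
    exact_mod_cast this
  have h1 : (1 + sqrtMulStar A)⁻¹ = conjDiagonal P (fun j => (1 + lam j : ℂ)⁻¹) := by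
    rw [sqrtMulStar_eq_conjDiagonal hlam hA, ← conjDiagonal_one P, ← conjDiagonal_add]
    exact conjDiagonal_inv P hp
  have h2 : (1 - sqrtMulStar A)⁻¹ = conjDiagonal P (fun j => (1 - lam j : ℂ)⁻¹) := by
    rw [sqrtMulStar_eq_conjDiagonal hlam hA]
    have : (1 : Matrix (Fin d) (Fin d) ℂ) - conjDiagonal P (fun j => (lam j : ℂ)) =
        conjDiagonal P (fun j => (1 - lam j : ℂ)) := by
      rw [sub_eq_iff_eq_add, ← conjDiagonal_add, ← conjDiagonal_one P]
      congr 1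
      ext j
      simp
    rw [this]
    exact conjDiagonal_inv P hm
  have hv : vVec A b = P (coordMul (fun j => (1 + lam j : ℂ)⁻¹) (P.symm b)) := by
    rw [vVec, h1, toEuclideanLin_conjDiagonal]
  rw [approxConst, h2, toEuclideanLin_conjDiagonal, hv, P.symm_apply_apply, P.inner_map_map,
    P.norm_map, Complex.ofReal_exp]
  congr 1
  rw [← Complex.ofReal_pow, EuclideanSpace.norm_sq_eq, PiLp.inner_apply]
  push_cast
  rw [Finset.sum_div, Finset.sum_div, ← Finset.sum_sub_distrib]
  refine Finset.sum_congr rfl fun j _ => ?_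
  have hpm : (1 - (lam j : ℂ) ^ 2) ≠ 0 := by
    rw [show (1 - (lam j : ℂ) ^ 2) = (1 + lam j) * (1 - lam j) by ring]
    exact mul_ne_zero (hp j) (hm j)
  simp only [coordMul_apply, RCLike.inner_apply, map_mul, map_inv₀, map_add, map_one,
    Complex.conj_ofReal, norm_mul, Complex.ofReal_mul, mul_pow]
  have hn1 : (((‖(1 + lam j : ℂ)⁻¹‖ : ℝ) : ℂ)) = (1 + lam j : ℂ)⁻¹ := by
    rw [show (1 + lam j : ℂ)⁻¹ = (((1 + lam j)⁻¹ : ℝ) : ℂ) by push_cast; rfl, Complex.norm_real,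
      Real.norm_of_nonneg (inv_nonneg.mpr (by linarith [hlam j]))]
  rw [hn1, ← Complex.conj_mul' (P.symm b j)]
  have := hp j
  have := hm j
  field_simp
  ring

end SVD

/-! ### Compactness forces the singular values below one -/

namespace Fock

variable {d : ℕ}

/-- A norm limit of a sequence that tends to zero pointwise vanishes, by Fatou's lemma. -/
theorem eq_zero_of_tendsto_of_pointwise {h : ℕ → Fock d} {g : Fock d}
    (hg : Filter.Tendsto h Filter.atTop (nhds g))
    (h0 : ∀ z, Filter.Tendsto (fun n => h n z) Filter.atTop (nhds 0)) : g = 0 := by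
  have hnorm : ∀ f : Fock d, ∫⁻ z, ENNReal.ofReal (‖f z‖ ^ 2 * Real.exp (-‖z‖ ^ 2 / 2)) =
      ENNReal.ofReal ((2 * Real.pi) ^ d * ‖f‖ ^ 2) := by
    intro f
    rw [← ofReal_integral_eq_lintegral_ofReal f.2.2
      (Filter.Eventually.of_forall fun z => by positivity), norm_sq_eq, mul_inv_cancel_left₀]
    positivity
  have hmeas : ∀ f : Fock d, Measurable fun z =>
      ENNReal.ofReal (‖f z‖ ^ 2 * Real.exp (-‖z‖ ^ 2 / 2)) := by
    intro f
    have := f.2.1.continuous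
    exact (Continuous.measurable (by fun_prop)).ennreal_ofReal
  have hfatou := lintegral_liminf_le (u := Filter.atTop) (μ := volume) fun n => hmeas (g - h n)
  have hlim : ∀ z, Filter.liminf (fun n =>
      ENNReal.ofReal (‖(g - h n) z‖ ^ 2 * Real.exp (-‖z‖ ^ 2 / 2))) Filter.atTop =
      ENNReal.ofReal (‖g z‖ ^ 2 * Real.exp (-‖z‖ ^ 2 / 2)) := by
    intro z
    refine Filter.Tendsto.liminf_eq (ENNReal.tendsto_ofReal ?_)
    have h1 : Filter.Tendsto (fun n => (g - h n) z) Filter.atTop (nhds (g z)) := by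
      simpa using (h0 z).const_sub (g z)
    exact (h1.norm.pow 2).mul_const _
  have hzero : Filter.Tendsto (fun n => ENNReal.ofReal ((2 * Real.pi) ^ d * ‖g - h n‖ ^ 2))
      Filter.atTop (nhds 0) := by
    have h1 := ((tendsto_const_nhds (x := g)).sub hg).norm
    rw [sub_self, norm_zero] at h1
    have h2 := (h1.pow 2).const_mul ((2 * Real.pi) ^ d)
    simpa using ENNReal.tendsto_ofReal h2
  simp only [hlim, hnorm] at hfatou
  rw [hzero.liminf_eq, nonpos_iff_eq_zero, ENNReal.ofReal_eq_zero] at hfatou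
  have hpos : (0 : ℝ) < (2 * Real.pi) ^ d := by positivity
  have : ‖g‖ ^ 2 ≤ 0 := nonpos_of_mul_nonpos_right hfatou hpos
  simpa using this

/-- The kernel function at `w`, up to a positive factor that makes its norm independent
of `w`. -/
noncomputable def kernel (w : CSpace d) : Fock d := weyl w (monomial 0)

theorem kernel_apply (w z : CSpace d) : kernel w z = weylFactor w z := by
  rw [kernel, weyl_apply, monomial_apply]
  simp

theorem norm_kernel (w : CSpace d) : ‖kernel w‖ = ‖(monomial 0 : Fock d)‖ :=
  (weyl w).norm_map _

theorem norm_weylFactor (w z : CSpace d) :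
    ‖weylFactor w z‖ = Real.exp ((inner ℂ w z : ℂ).re / 2 - ‖w‖ ^ 2 / 4) := by
  rw [weylFactor, Complex.norm_exp, Complex.sub_re,
    show ((‖w‖ : ℂ) ^ 2 / 4) = ((‖w‖ ^ 2 / 4 : ℝ) : ℂ) by push_cast; rfl, Complex.ofReal_re,
    Complex.div_ofNat_re]

/-- If a compact composition operator had a singular value `λ_j ≥ 1`, the normalised kernel
functions at `w = ±t y_j`, `t → ∞`, for the left singular vector `y_j` and a suitable sign, would
have images that are bounded below in norm, but tend to zero pointwise. -/
theorem singularValue_lt_one {A : Matrix (Fin d) (Fin d) ℂ} {b : CSpace d}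
    {T : Fock d →L[ℂ] Fock d} (hT : IsCompositionOperator (affineSymbol A b) T)
    (hcomp : IsCompactOperator T) {lam : Fin d → ℝ} {P R : CSpace d ≃ₗᵢ[ℂ] CSpace d}
    (hA : ∀ z, A.toEuclideanLin z = P (coordMul (fun j => (lam j : ℂ)) (R z))) (j : Fin d) :
    lam j < 1 := by
  by_contra! hj
  -- `y` is a left singular vector for `λ_j`, its sign chosen by `b`, and `x = A* y`
  obtain ⟨y, hy, hyb, x, hx, hxy⟩ : ∃ y : CSpace d, ‖y‖ = 1 ∧ 0 ≤ (inner ℂ y b : ℂ).re ∧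
      ∃ x : CSpace d, 1 ≤ ‖x‖ ∧ ∀ z, inner ℂ y (A.toEuclideanLin z) = inner ℂ x z := by
    have h : ∀ μ : ℝ, |μ| = 1 → 0 ≤ μ * (inner ℂ (P (EuclideanSpace.single j 1)) b : ℂ).re →
        ∃ y : CSpace d, ‖y‖ = 1 ∧ 0 ≤ (inner ℂ y b : ℂ).re ∧
        ∃ x : CSpace d, 1 ≤ ‖x‖ ∧ ∀ z, inner ℂ y (A.toEuclideanLin z) = inner ℂ x z := by
      intro μ hμ hμb
      refine ⟨P ((μ : ℂ) • EuclideanSpace.single j 1), ?_, ?_,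
        R.symm (((μ * lam j : ℝ) : ℂ) • EuclideanSpace.single j 1), ?_, fun z => ?_⟩
      · simp [norm_smul, hμ]
      · rw [map_smul, inner_smul_left, Complex.conj_ofReal, Complex.re_ofReal_mul]
        exact hμb
      · rw [R.symm.norm_map, norm_smul, Complex.norm_real, Real.norm_eq_abs, abs_mul, hμ,
          PiLp.norm_single, norm_one, one_mul, mul_one]
        exact hj.trans (le_abs_self _)
      · rw [hA, P.inner_map_map, ← R.inner_map_map (R.symm _), R.apply_symm_apply,
          inner_smul_left, inner_smul_left, EuclideanSpace.inner_single_left,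
          EuclideanSpace.inner_single_left, coordMul_apply]
        simp only [Complex.conj_ofReal]
        push_cast
        ring
    rcases le_total 0 (inner ℂ (P (EuclideanSpace.single j 1)) b : ℂ).re with h0 | h0
    · exact h 1 (by simp) (by simpa using h0)
    · exact h (-1) (by simp) (by simpa using h0)
  -- `T` maps the kernel at `n y` to a multiple of the kernel at `n A* y = n x`
  set f : ℕ → Fock d := fun n => kernel ((n : ℂ) • y)
  have hfactor : ∀ n, T (f n) = Complex.exp (n * inner ℂ y b / 2 +
      (n : ℂ) ^ 2 * ((‖x‖ : ℂ) ^ 2 - 1) / 4) • kernel ((n : ℂ) • x) := by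
    intro n
    ext z
    rw [hT, smul_apply, kernel_apply, kernel_apply, weylFactor, weylFactor, ← Complex.exp_add,
      affineSymbol, inner_add_right, inner_smul_left, inner_smul_left, inner_smul_left, hxy,
      norm_smul, norm_smul, hy]
    congr 1
    simp only [Complex.conj_natCast, Complex.norm_natCast]
    push_cast
    ring
  have hlower : ∀ n, ‖(monomial 0 : Fock d)‖ ≤ ‖T (f n)‖ := by
    intro n
    rw [hfactor, norm_smul, norm_kernel, Complex.norm_exp]
    refine le_mul_of_one_le_left (norm_nonneg _) (Real.one_le_exp ?_)
    have h1 : ((n : ℂ) * inner ℂ y b / 2 + (n : ℂ) ^ 2 * ((‖x‖ : ℂ) ^ 2 - 1) / 4 : ℂ).re =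
        n * (inner ℂ y b : ℂ).re / 2 + n ^ 2 * (‖x‖ ^ 2 - 1) / 4 := by
      rw [Complex.add_re, show ((n : ℂ) ^ 2 * ((‖x‖ : ℂ) ^ 2 - 1) / 4) =
        (((n : ℝ) ^ 2 * (‖x‖ ^ 2 - 1) / 4 : ℝ) : ℂ) by push_cast; rfl, Complex.ofReal_re,
        Complex.div_ofNat_re, ← Complex.ofReal_natCast, Complex.re_ofReal_mul]
    rw [h1]
    have h2 : 0 ≤ ‖x‖ ^ 2 - 1 := by nlinarith
    positivity
  have hpoint : ∀ z, Filter.Tendsto (fun n => T (f n) z) Filter.atTop (nhds 0) := by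
    intro z
    rw [tendsto_zero_iff_norm_tendsto_zero]
    have h1 : ∀ n, ‖T (f n) z‖ =
        Real.exp ((n : ℝ) * ((inner ℂ y (affineSymbol A b z) : ℂ).re / 2 - n / 4)) := by
      intro n
      rw [hT, kernel_apply, norm_weylFactor, inner_smul_left, norm_smul, hy, Complex.conj_natCast,
        ← Complex.ofReal_natCast, Complex.re_ofReal_mul, Complex.norm_real, Real.norm_natCast]
      congr 1
      ring
    simp only [h1]
    refine Real.tendsto_exp_atBot.comp ?_
    refine Filter.Tendsto.atTop_mul_atBot₀ tendsto_natCast_atTop_atTop ?_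
    have h2 : Filter.Tendsto (fun n : ℕ => (n : ℝ) / 4) Filter.atTop Filter.atTop :=
      tendsto_natCast_atTop_atTop.atTop_div_const (by norm_num)
    simpa only [sub_eq_add_neg, Function.comp_apply] using
      Filter.tendsto_atBot_add_const_left _ _ (Filter.tendsto_neg_atTop_atBot.comp h2)
  obtain ⟨K, hK, hTK⟩ := IsCompactOperator.image_closedBall_subset_compact
    (f := (T : Fock d →ₗ[ℂ] Fock d)) hcomp ‖(monomial 0 : Fock d)‖
  have hmem : ∀ n, T (f n) ∈ K := fun n =>
    hTK ⟨f n, mem_closedBall_zero_iff.mpr (norm_kernel _).le, rfl⟩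
  obtain ⟨g, -, φ, hφ, hg⟩ := hK.tendsto_subseq hmem
  have hg0 : g = 0 := eq_zero_of_tendsto_of_pointwise hg
    fun z => (hpoint z).comp hφ.tendsto_atTop
  have h1 : ‖(monomial 0 : Fock d)‖ ≤ ‖g‖ :=
    ge_of_tendsto' hg.norm fun n => hlower (φ n)
  rw [hg0, norm_zero] at h1
  exact monomial_ne_zero (0 : Fin d → ℕ) (norm_le_zero_iff.mp h1)

end Fock

/-! ### Summation over multi-indices and the Schmidt decomposition -/

section Enumeration

/-- The elements of an infinite set on which a summable family is positive can be listed in such a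
way that the values do not increase. They are ordered by value, ties being broken by an injection
into the natural numbers; then every element has only finitely many predecessors. -/
theorem exists_antitone_enumeration {ι : Type*} [Countable ι] {S : Set ι} (hS : S.Infinite)
    {s : ι → ℝ} (hpos : ∀ i ∈ S, 0 < s i) (hsum : Summable s) :
    ∃ α : ℕ → ι, Set.BijOn α Set.univ S ∧ Antitone fun n => s (α n) := by
  obtain ⟨code, hcode⟩ := exists_injective_nat S
  have hinf : Infinite S := hS.to_subtype
  let key : S → ℝᵒᵈ ×ₗ ℕ := fun i => toLex (OrderDual.toDual (s i), code i)
  have hkey : Function.Injective key := fun i j h =>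
    hcode (congrArg (fun p => (ofLex p).2) h)
  let : LinearOrder S := LinearOrder.lift' key hkey
  have hle : ∀ i j : S, i ≤ j → s j ≤ s i := by
    intro i j h
    rcases (Prod.Lex.le_iff).mp (show key i ≤ key j from h) with h | h
    · exact le_of_lt (OrderDual.toDual_lt_toDual.mp h)
    · exact (OrderDual.toDual_inj.mp h.1).ge
  have hfin : ∀ j : S, (Set.Iic j).Finite := by
    intro j
    have h1 : ∀ᶠ i in Filter.cofinite, s i < s j :=
      hsum.tendsto_cofinite_zero.eventually_lt_const (hpos j j.2)
    have h2 : {i : ι | ¬ s i < s j}.Finite := h1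
    refine (h2.preimage Subtype.val_injective.injOn).subset fun i hi => ?_
    exact not_lt.mpr (hle i j hi)
  let : LocallyFiniteOrder S := LocallyFiniteOrder.ofFiniteIcc fun a b =>
    (hfin b).subset Set.Icc_subset_Iic_self
  have : NoMaxOrder S := ⟨fun a => by
    obtain ⟨b, hb⟩ := (hfin a).exists_notMem
    exact ⟨b, not_le.mp hb⟩⟩
  obtain ⟨m, hm⟩ : ∃ m : S, ∀ i, m ≤ i := by
    obtain ⟨a⟩ := hinf.nonempty
    obtain ⟨m, hma, hm⟩ := (hfin a).exists_minimal ⟨a, le_refl a⟩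
    refine ⟨m, fun i => ?_⟩
    rcases le_total m i with h | h
    · exact h
    · exact hm (h.trans hma) h
  let : OrderBot S := { bot := m, bot_le := hm }
  let : SuccOrder S := LinearLocallyFiniteOrder.succOrder S
  let : PredOrder S := LinearLocallyFiniteOrder.predOrder S
  let e : ℕ ≃o S := orderIsoNatOfLinearSuccPredArch.symm
  refine ⟨fun n => (e n : ι), ⟨fun n _ => (e n).2, fun a _ b _ h => e.injective (Subtype.ext h),
    fun i hi => ⟨e.symm ⟨i, hi⟩, trivial, by simp⟩⟩, fun a b h => hle _ _ (e.monotone h)⟩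

end Enumeration

section MultiPow

theorem multiPow_nonneg {d : ℕ} {lam : Fin d → ℝ} (h0 : ∀ j, 0 ≤ lam j) (α : Fin d → ℕ) :
    0 ≤ multiPow lam α :=
  Finset.prod_nonneg fun j _ => pow_nonneg (h0 j) _

theorem hasSum_multiPow {d : ℕ} {lam : Fin d → ℝ} (h0 : ∀ j, 0 ≤ lam j) (h1 : ∀ j, lam j < 1) :
    HasSum (multiPow lam) (∏ j, 1 / (1 - lam j)) := by
  induction d with
  | zero => simpa [multiPow] using hasSum_unique (multiPow lam)
  | succ d ih =>
    have h2 := ih (fun j => h0 j.succ) (fun j => h1 j.succ)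
    have h3 := hasSum_geometric_of_lt_one (h0 0) (h1 0)
    have h4 := h3.mul h2 (h3.summable.mul_of_nonneg h2.summable
      (fun n => pow_nonneg (h0 0) n) (fun α => multiPow_nonneg (fun j => h0 j.succ) α))
    rw [Fin.prod_univ_succ, one_div, ← (Fin.consEquiv fun _ => ℕ).hasSum_iff]
    have h5 : multiPow lam ∘ (Fin.consEquiv fun _ => ℕ) =
        fun x => lam 0 ^ x.1 * multiPow (fun j => lam j.succ) x.2 := by
      funext x
      simp [multiPow, Fin.prod_univ_succ, Fin.consEquiv]
    rw [h5]
    exact h4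

theorem infinite_setOf_multiPow_ne_zero {d : ℕ} {lam : Fin d → ℝ} {j : Fin d} (hj : lam j ≠ 0) :
    {β : Fin d → ℕ | multiPow lam β ≠ 0}.Infinite := by
  refine Set.infinite_of_injective_forall_mem (f := fun n : ℕ => Pi.single j n)
    (fun a c h => Pi.single_injective (M := fun _ => ℕ) j h) fun n => ?_
  refine Finset.prod_ne_zero_iff.mpr fun i _ => ?_
  rcases eq_or_ne i j with rfl | h
  · simpa using pow_ne_zero n hj
  · simp [h]

end MultiPow

namespace Fock

variable {d : ℕ}

/-- The Schmidt decomposition of the composition operator: up to unitary changes of coordinates it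
is the dilation `f(z) ↦ f(λ₁ z₁, …, λ_d z_d)` between two Weyl operators, and the dilation is
diagonal in the monomials. -/
theorem exists_orthonormal_diagonal {A : Matrix (Fin d) (Fin d) ℂ} {b : CSpace d}
    {T : Fock d →L[ℂ] Fock d} (hT : IsCompositionOperator (affineSymbol A b) T) {lam : Fin d → ℝ}
    (hlam : ∀ j, 0 ≤ lam j) (hlam1 : ∀ j, lam j < 1) {P R : CSpace d ≃ₗᵢ[ℂ] CSpace d}
    (hA : ∀ z, A.toEuclideanLin z = P (coordMul (fun j => (lam j : ℂ)) (R z))) :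
    ∃ e g : (Fin d → ℕ) → Fock d, Orthonormal ℂ e ∧ Orthonormal ℂ g ∧
      (Submodule.span ℂ (Set.range e)).topologicalClosure = ⊤ ∧
      ∀ α, T (e α) = ((Real.exp (∑ j, ‖P.symm b j‖ ^ 2 / (4 * (1 - lam j ^ 2))) *
        multiPow lam α : ℝ) : ℂ) • g α := by
  have hq : ∀ j, (1 - (lam j : ℂ) ^ 2) ≠ 0 := fun j => by
    have : (1 - lam j ^ 2 : ℝ) ≠ 0 := by nlinarith [hlam j, hlam1 j]
    exact_mod_cast this
  set D : CSpace d →L[ℂ] CSpace d := coordMul fun j => (lam j : ℂ)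
  set c : CSpace d := P.symm b
  -- the two translations are determined by `D (ζ - p) = D ζ + c + u` and `p = -D u`
  set u : CSpace d := coordMul (fun j => -(1 - (lam j : ℂ) ^ 2)⁻¹) c
  set p : CSpace d := -D u
  have hcu : ∀ ζ, D (ζ - p) = D ζ + c + u := by
    intro ζ
    ext j
    have := hq j
    simp only [D, p, u, coordMul_apply, PiLp.sub_apply, PiLp.neg_apply, PiLp.add_apply]
    field_simp
    ring
  have hfactor : ∀ ζ, weylFactor (-u) (D ζ + c) =
      (Real.exp (∑ j, ‖c j‖ ^ 2 / (4 * (1 - lam j ^ 2))) : ℂ) * weylFactor p ζ := by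
    intro ζ
    rw [weylFactor, weylFactor, Complex.ofReal_exp, ← Complex.exp_add]
    congr 1
    simp only [p, norm_neg, inner_neg_left, inner_add_right]
    rw [← Complex.ofReal_pow, ← Complex.ofReal_pow, EuclideanSpace.norm_sq_eq,
      EuclideanSpace.norm_sq_eq, PiLp.inner_apply, PiLp.inner_apply, PiLp.inner_apply]
    push_cast
    simp only [Finset.sum_div, ← Finset.sum_add_distrib, ← Finset.sum_sub_distrib,
      ← Finset.sum_neg_distrib]
    refine Finset.sum_congr rfl fun j _ => ?_
    have := hq j
    simp only [D, u, coordMul_apply, RCLike.inner_apply, map_mul, map_neg, map_inv₀, map_sub,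
      map_one, map_pow, Complex.conj_ofReal, ← Complex.conj_mul']
    field_simp
    ring
  refine ⟨fun α => (compUnitary P).symm (weyl (-u) (unitMonomial α)),
    fun α => compUnitary R (weyl p (unitMonomial α)),
    (orthonormal_unitMonomial.comp_linearIsometryEquiv (weyl (-u))).comp_linearIsometryEquiv
      (compUnitary P).symm,
    (orthonormal_unitMonomial.comp_linearIsometryEquiv (weyl p)).comp_linearIsometryEquiv
      (compUnitary R), ?_, fun α => ?_⟩
  · set Φ : Fock d ≃ₗᵢ[ℂ] Fock d := (weyl (-u)).trans (compUnitary P).symm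
    rw [← Submodule.dense_iff_topologicalClosure_eq_top]
    have h1 : Dense ((Submodule.span ℂ (Set.range (unitMonomial (d := d))) :
        Submodule ℂ (Fock d)) : Set (Fock d)) :=
      Submodule.dense_iff_topologicalClosure_eq_top.mpr topologicalClosure_span_unitMonomial
    have h2 := Φ.surjective.denseRange.dense_image Φ.continuous h1
    have h3 : Submodule.span ℂ (Set.range fun α => Φ (unitMonomial α)) =
        (Submodule.span ℂ (Set.range (unitMonomial (d := d)))).map
          Φ.toLinearEquiv.toLinearMap := by
      rw [Submodule.map_span, ← Set.range_comp]
      rfl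
    change Dense ((Submodule.span ℂ (Set.range fun α => Φ (unitMonomial α)) :
      Submodule ℂ (Fock d)) : Set (Fock d))
    rw [h3]
    exact h2
  · ext z
    rw [hT, compUnitary_symm_apply, weyl_apply, smul_apply, compUnitary_apply, weyl_apply,
      affineSymbol, hA, map_add, P.symm_apply_apply, sub_neg_eq_add, hfactor, ← hcu,
      unitMonomial_coordMul, multiPow]
    push_cast
    ring

end Fock

theorem mainTheorem6 (d : ℕ) (A : Matrix (Fin d) (Fin d) ℂ) (hA : A ≠ 0) (b : CSpace d)
    (T : Fock d →L[ℂ] Fock d) (hT : IsCompositionOperator (affineSymbol A b) T)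
    (hcomp : IsCompactOperator T)
    (lam : Fin d → ℝ) (hlam : IsSingularValues A lam) :
    (∀ α : ℕ → (Fin d → ℕ),
      Set.BijOn α Set.univ {β : Fin d → ℕ | multiPow lam β ≠ 0} →
      Antitone (fun n => multiPow lam (α n)) →
      ∀ n : ℕ, (approxNumber T (n + 1) : ℂ) = approxConst A b * (multiPow lam (α n) : ℂ)) ∧
    HasSum (fun n : ℕ => (approxNumber T (n + 1) : ℂ))
      (approxConst A b * ∏ j, (1 / (1 - (lam j : ℂ)))) := by
  have hlam0 := singularValues_nonneg hlam
  obtain ⟨P, R, hPR⟩ := exists_singularValueDecomposition hlam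
  have hlam1 := Fock.singularValue_lt_one hT hcomp hPR
  obtain ⟨e, g, he, hg, htotal, hTe⟩ := Fock.exists_orthonormal_diagonal hT hlam0 hlam1 hPR
  rw [approxConst_eq hlam0 hlam1 hPR b]
  set κ : ℝ := Real.exp (∑ j, ‖P.symm b j‖ ^ 2 / (4 * (1 - lam j ^ 2)))
  have hnonneg := fun β => multiPow_nonneg hlam0 β
  have main : ∀ α : ℕ → (Fin d → ℕ),
      Set.BijOn α Set.univ {β : Fin d → ℕ | multiPow lam β ≠ 0} →
      Antitone (fun n => multiPow lam (α n)) →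
      ∀ n : ℕ, approxNumber T (n + 1) = κ * multiPow lam (α n) := by
    intro α hα hanti n
    refine approxNumber_of_diagonal he hg htotal (s := fun β => κ * multiPow lam β)
      (fun β => mul_nonneg (Real.exp_pos _).le (hnonneg β)) hTe
      (Set.injOn_univ.mp hα.injOn) (fun β hβ => ?_)
      (fun m n hmn => mul_le_mul_of_nonneg_left (hanti hmn) (Real.exp_pos _).le) n
    have : multiPow lam β = 0 := by
      by_contra h
      obtain ⟨n, -, hn⟩ := hα.surjOn h
      exact hβ ⟨n, hn⟩
    simp only [this, mul_zero]
  refine ⟨fun α hα hanti n => by rw [main α hα hanti n]; push_cast; rfl, ?_⟩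
  -- as `A ≠ 0`, the nonzero products `λ ^ β` are infinitely many and can be enumerated by `ℕ`
  obtain ⟨j, hj⟩ : ∃ j, lam j ≠ 0 := by
    by_contra! h
    refine hA (Matrix.toEuclideanLin.injective (LinearMap.ext fun z => ?_))
    have h0 : coordMul (fun j => (lam j : ℂ)) (R z) = 0 := by ext j; simp [h]
    rw [hPR, h0, map_zero, map_zero, LinearMap.zero_apply]
  have hsum := hasSum_multiPow hlam0 hlam1
  obtain ⟨α, hα, hanti⟩ := exists_antitone_enumeration (infinite_setOf_multiPow_ne_zero hj)
    (fun β hβ => (hnonneg β).lt_of_ne' hβ) hsum.summable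
  have h1 : HasSum (fun n => multiPow lam (α n)) (∏ j, 1 / (1 - lam j)) := by
    refine ((Set.injOn_univ.mp hα.injOn).hasSum_iff fun β hβ => ?_).mpr hsum
    by_contra h
    obtain ⟨n, -, hn⟩ := hα.surjOn h
    exact hβ ⟨n, hn⟩
  have h2 := Complex.hasSum_ofReal.mpr (h1.mul_left κ)
  simp only [main α hα hanti]
  convert h2 using 1
  push_cast
  rfl
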